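/- Consider an $M|G|\infty$ queue with Poisson arrivals of rate $\lambda>0$, infinitely many servers, and independent, identically distributed service times, independent of the arrivals, with distribution function $G$ on $[0,\infty)$ and finite mean $\alpha=\int_0^\infty(1-G(x))\,dx>0$. Let $\rho=\lambda\alpha$, let $F(t)=\frac1\alpha\int_0^t(1-G(x))\,dx$ $(t\ge 0)$ be the equilibrium service distribution function and let $f=dF/dt$ be its density, the derivative being taken from the right, so that $f(t)=(1-G(t))/\alpha$ for all $t\ge 0$. Put $f^{*1}=f$ and $f^{*(n+1)}(t)=\int_0^t f(t-s)f^{*n}(s)\,ds$. Let $B$ be the length of a busy period, that is, the time from the arrival of a customer who finds the system empty until the system is next empty (the first such customer, when the system is empty at time $0$). Then for every $t\ge 0$ the two series below converge, and $$1-\lambda^{-1}\sum_{n=1}^\infty \rho^n f^{*n}(t)\ \le\ P(B\le t)\ \le\ 1-\lambda^{-1}\sum_{n=1}^\infty \rho^n e^{-n\rho} f^{*n}(t).$$ -/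

import Mathlib

open MeasureTheory ProbabilityTheory

noncomputable section

namespace MGInf

/-- The data of an `M|G|∞` queue that is empty at time `0`: `X n` is the time between the arrivals
of customers `n - 1` and `n` (`X 0` is the arrival time of the first customer), `S n` is the service
time of customer `n`. Arrivals form a Poisson process of rate `lam` (independent exponential
interarrival times), service times have law `ν` on `[0, ∞)`, everything is independent. Since there
are infinitely many servers, every customer starts service upon arrival. -/
structure IsQueue {Ω : Type*} [MeasurableSpace Ω] (P : Measure Ω) (lam : ℝ) (ν : Measure ℝ)
    (X S : ℕ → Ω → ℝ) : Prop where
  rate_pos : 0 < lam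
  service_nonneg : ν (Set.Iio 0) = 0
  interarrival_law : ∀ n, HasLaw (X n) (expMeasure lam) P
  service_law : ∀ n, HasLaw (S n) ν P
  indep : iIndepFun (fun i : ℕ ⊕ ℕ => Sum.elim X S i) P

/-- Arrival time of customer `n` (customers are numbered from `0`), for one sample path `x` of
interarrival times. -/
def arrivalTime (x : ℕ → ℝ) (n : ℕ) : ℝ := ∑ i ∈ Finset.range (n + 1), x i

/-- The set of customers present in the system at time `t`, for one sample path `x` of interarrival
times and `s` of service times: those that have arrived and not yet left. -/
def present (x s : ℕ → ℝ) (t : ℝ) : Set ℕ :=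
  {n | arrivalTime x n ≤ t ∧ t < arrivalTime x n + s n}

/-- The length of the busy period that starts with the first arrival: the time from that arrival
until the system is empty (`⊤` if that never happens). -/
def busyPeriod (x s : ℕ → ℝ) : EReal :=
  sInf ((fun u : ℝ => (u : EReal)) '' {u : ℝ | 0 ≤ u ∧ present x s (arrivalTime x 0 + u) = ∅})

/-- The mean service time `α`. -/
def meanService (ν : Measure ℝ) : ℝ := ∫ x, x ∂ν

/-- The equilibrium distribution function `F(t) = α⁻¹ ∫₀ᵗ (1 - G(x)) dx`, `t ≥ 0`. -/
def equilibriumCDF (ν : Measure ℝ) (t : ℝ) : ℝ :=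
  (meanService ν)⁻¹ * ∫ x in (0 : ℝ)..t, (1 - cdf ν x)

/-- The equilibrium density `f = dF/dt`. The derivative is taken from the right, so that it exists
at every `t ≥ 0`, also where `G` jumps. -/
def equilibriumDensity (ν : Measure ℝ) (t : ℝ) : ℝ :=
  derivWithin (equilibriumCDF ν) (Set.Ici t) t

theorem hasDerivWithinAt_equilibriumCDF (ν : Measure ℝ) (t : ℝ) :
    HasDerivWithinAt (equilibriumCDF ν) ((1 - cdf ν t) / meanService ν) (Set.Ici t) t := by
  have hanti : Antitone (fun x => 1 - cdf ν x) := fun a b h => by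
    have := monotone_cdf ν h
    simp only; linarith
  have hc : ContinuousWithinAt (fun x => 1 - cdf ν x) (Set.Ici t) t :=
    continuousWithinAt_const.sub ((cdf ν).right_continuous t)
  have h := intervalIntegral.integral_hasDerivWithinAt_right (s := Set.Ici t) (t := Set.Ioi t)
    (hanti.intervalIntegrable (μ := volume) (a := 0) (b := t))
    (hanti.measurable.stronglyMeasurable.stronglyMeasurableAtFilter)
    (hc.mono Set.Ioi_subset_Ici_self)
  have h2 := h.const_mul (meanService ν)⁻¹
  rw [div_eq_inv_mul]
  exact h2

theorem equilibriumDensity_eq (ν : Measure ℝ) (t : ℝ) :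
    equilibriumDensity ν t = (1 - cdf ν t) / meanService ν :=
  (hasDerivWithinAt_equilibriumCDF ν t).derivWithin (uniqueDiffOn_Ici t t Set.self_mem_Ici)

/-- Convolution powers of a function on `[0, ∞)`: `convPow f n` is the `(n + 1)`-fold convolution
`f^{*(n+1)}`, so `convPow f 0 = f`. -/
def convPow (f : ℝ → ℝ) : ℕ → ℝ → ℝ
  | 0 => f
  | n + 1 => fun t => ∫ s in (0 : ℝ)..t, f (t - s) * convPow f n s

end MGInf

end

open MeasureTheory ProbabilityTheory

noncomputable section

namespace MGInf

/-! ### Sample paths -/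

/-! The tail of B satisfies a renewal equation whose kernel lies between two multiples of `f`;
iterating the equation then gives the two series.

Suppose the system is busy throughout [0, t], and look at the most recent arrival still present at
t. The arrivals are Poisson, so its age has density g(w) = λ(1 - G(w)) exp(-λ∫₀ʷ(1 - G)), which is
`lastDensity`. The system must have been busy up to t - w, and this customer keeps it busy from then
on. If no later arrival is present, the initial customer alone must still be there. Hence H(t) =
λP(B > t) satisfies H = g + g * H (`IsQueue.busyTail_eq`, `IsQueue.renewal_busyTail`). Since ∫₀ʷ(1 -
G) ≤ α, the exponential lies in [e^{-ρ}, 1], so ρe^{-ρ}f ≤ g ≤ ρf. Positivity and induction compare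
H with the partial sums of both series (`convSum_le_of_renewal`, `le_convSum_of_renewal`), up to a
factorially small remainder in the second case.

The last-arrival decomposition is not derived from point-process theory. The interarrival
description gives a first-arrival recursion V_{n+1} = a + A V_n for the busy probabilities of a
system fed by n arrivals (`IsQueue.integral_stay`). The wanted equation is V = ψ + L V, with L the
convolution by `lastMeasure`. The operators A and L commute (`firstArrival_lastConv`), and the
sources satisfy Aψ + a = ψ + La (`firstArrival_vac_add`, resting on `vac_renewal`). So the defect
V_n - ψ - L V_n is multiplied by A at each step. In the norm weighted by e^{-λt}, A halves sizes,
because E e^{-λX} = 1/2 (`abs_firstArrival_le`). The defect therefore tends to 0, and V_n, averaged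
over the first service time, tends to P(B > t) (`IsQueue.tendsto_busyTail`). -/

/-- Indicator of the event that a system with residual work `r` at time `0`, fed by its first `n`
later arrivals only, is never empty on `[0, t]`; it is `0` for `t < 0`. -/
def stay : ℕ → (ℕ → ℝ) → (ℕ → ℝ) → ℝ → ℝ → ℝ
  | 0, _, _, r, t => if 0 ≤ t ∧ t < r then 1 else 0
  | n + 1, x, s, r, t =>
    (if (0 ≤ t ∧ t < r) ∧ t < x 0 then 1 else 0) +
      if x 0 ≤ r then stay n (fun i => x (i + 1)) (fun i => s (i + 1)) (max (r - x 0) (s 0)) (t - x 0)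
      else 0

/-- A system with residual work `r` at time `0` and later arrivals given by `x`, `s` is never empty
on `[0, t]`. -/
def Covered (x s : ℕ → ℝ) (r t : ℝ) : Prop :=
  ∀ u, 0 ≤ u → u ≤ t → u < r ∨ (present x s u).Nonempty

/-- This makes the two summands in the recursion for `stay` mutually exclusive: the restarted term
dies when the first arrival comes after t. -/
theorem stay_of_neg (n : ℕ) (x s : ℕ → ℝ) (r t : ℝ) (ht : t < 0) (hx : ∀ i, 0 < x i) :
    stay n x s r t = 0 := by
  induction n generalizing x s r t with
  | zero => simp [stay, not_le.2 ht]
  | succ n ih =>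
    have h0 := hx 0
    simp only [stay, not_le.2 ht, false_and, if_false, zero_add]
    rw [ih _ _ _ _ (by linarith) fun i => hx (i + 1), ite_self]

theorem arrivalTime_zero (x : ℕ → ℝ) : arrivalTime x 0 = x 0 := by simp [arrivalTime]

theorem arrivalTime_succ (x : ℕ → ℝ) (n : ℕ) :
    arrivalTime x (n + 1) = x 0 + arrivalTime (fun i => x (i + 1)) n := by
  rw [arrivalTime, Finset.sum_range_succ', add_comm]; rfl

theorem arrivalTime_pos {x : ℕ → ℝ} (hx : ∀ i, 0 < x i) (n : ℕ) : 0 < arrivalTime x n :=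
  Finset.sum_pos (fun i _ => hx i) (by simp)

theorem present_shift_nonempty_iff {x s : ℕ → ℝ} (u : ℝ) (hu : x 0 ≤ u) :
    (present x s u).Nonempty ↔ u - x 0 < s 0 ∨
      (present (fun i => x (i + 1)) (fun i => s (i + 1)) (u - x 0)).Nonempty := by
  constructor
  · rintro ⟨_ | n, h1, h2⟩
    · rw [arrivalTime_zero] at h2
      left; linarith
    · rw [arrivalTime_succ] at h1 h2
      right; exact ⟨n, by linarith, by linarith⟩
  · rintro (h | ⟨n, h1, h2⟩)
    · exact ⟨0, by rwa [arrivalTime_zero], by rw [arrivalTime_zero]; linarith⟩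
    · exact ⟨n + 1, by rw [arrivalTime_succ]; linarith, by rw [arrivalTime_succ]; linarith⟩

theorem present_eq_empty_of_lt {x s : ℕ → ℝ} (hx : ∀ i, 0 < x i) {u : ℝ} (hu : u < x 0) :
    ¬(present x s u).Nonempty := by
  rintro ⟨_ | n, h1, _⟩
  · rw [arrivalTime_zero] at h1; linarith
  · rw [arrivalTime_succ] at h1
    have := arrivalTime_pos (fun i => hx (i + 1)) n
    linarith

theorem covered_of_lt_iff {x s : ℕ → ℝ} (hx : ∀ i, 0 < x i) {r t : ℝ} (ht : 0 ≤ t)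
    (htx : t < x 0) : Covered x s r t ↔ t < r := by
  constructor
  · intro h
    exact (h t ht le_rfl).resolve_right (present_eq_empty_of_lt hx htx)
  · intro h u _ hut
    left; linarith

/-- The path regenerates at the first arrival: with infinitely many servers, only the larger of the
remaining initial work and the new service time matters. Equality `x 0 = r` is allowed because the
arriving customer is counted at its arrival instant. -/
theorem covered_shift_iff {x s : ℕ → ℝ} (hx : ∀ i, 0 < x i) {r t : ℝ} (htx : x 0 ≤ t) :
    Covered x s r t ↔ x 0 ≤ r ∧
      Covered (fun i => x (i + 1)) (fun i => s (i + 1)) (max (r - x 0) (s 0)) (t - x 0) := by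
  have h0 := hx 0
  constructor
  · intro h
    refine ⟨?_, fun u hu hut => ?_⟩
    · by_contra! hr
      -- At this time the initial work is exhausted and nobody has arrived yet; the maximum covers
      -- negative r.
      rcases h (max r 0) (le_max_right _ _) (by simp; constructor <;> linarith) with h1 | h1
      · exact absurd h1 (not_lt.2 (le_max_left _ _))
      · exact present_eq_empty_of_lt hx (max_lt hr h0) h1
    · rw [lt_max_iff]
      rcases h (u + x 0) (by linarith) (by linarith) with h1 | h1
      · left; left; linarith
      · rw [present_shift_nonempty_iff _ (by linarith), add_sub_cancel_right] at h1
        tauto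
  · rintro ⟨hr, h⟩ u hu hut
    by_cases hux : u < x 0
    · left; linarith
    · rw [present_shift_nonempty_iff _ (by linarith)]
      have := h (u - x 0) (by linarith) (by linarith)
      rw [lt_max_iff] at this
      rcases this with (h1 | h1) | h1
      · left; linarith
      · tauto
      · tauto

-- Truncation to n arrivals is harmless once the first omitted arrival, which has index n, falls
-- after t.
open Classical in
theorem stay_eq_ite_covered (n : ℕ) {x s : ℕ → ℝ} (hx : ∀ i, 0 < x i) {r t : ℝ} (ht : 0 ≤ t)
    (hn : t < arrivalTime x n) : stay n x s r t = if Covered x s r t then 1 else 0 := by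
  induction n generalizing x s r t with
  | zero =>
    rw [arrivalTime_zero] at hn
    simp [stay, covered_of_lt_iff hx ht hn, ht]
  | succ n ih =>
    rw [arrivalTime_succ] at hn
    by_cases htx : t < x 0
    · simp only [stay, covered_of_lt_iff hx ht htx, ht, htx, true_and, and_true]
      rw [stay_of_neg n _ _ _ _ (by linarith) fun i => hx (i + 1), ite_self, add_zero]
    · rw [not_lt] at htx
      simp only [stay, covered_shift_iff hx htx, not_lt.2 htx, and_false, if_false, zero_add]
      rw [ih (fun i => hx (i + 1)) (by linarith) (by linarith), ite_and]

theorem busyPeriod_le_iff {x s : ℕ → ℝ} {t : ℝ} (ht : 0 ≤ t) :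
    busyPeriod x s ≤ (t : EReal) ↔
      ¬Covered (fun i => x (i + 1)) (fun i => s (i + 1)) (s 0) t := by
  have key : ∀ u : ℝ, 0 ≤ u → ((present x s (arrivalTime x 0 + u)).Nonempty ↔
      u < s 0 ∨ (present (fun i => x (i + 1)) (fun i => s (i + 1)) u).Nonempty) := by
    intro u hu
    rw [arrivalTime_zero, present_shift_nonempty_iff _ (by linarith), add_sub_cancel_left]
  constructor
  · intro h hc
    have hne : (present x s (arrivalTime x 0 + t)).Nonempty :=
      (key t ht).2 (hc t ht le_rfl)
    obtain ⟨n, h1, h2⟩ := hne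
    -- The infimum need not be attained a priori. But a customer present at t leaves strictly later,
    -- so an infimum at most t forces an empty instant before that departure, either in [0, t] or
    -- while this customer is present.
    have hlt : busyPeriod x s < ((arrivalTime x n + s n - arrivalTime x 0 : ℝ) : EReal) :=
      lt_of_le_of_lt h (by exact_mod_cast (by linarith))
    rw [busyPeriod, sInf_lt_iff] at hlt
    obtain ⟨_, ⟨u, ⟨hu0, hu⟩, rfl⟩, hlt⟩ := hlt
    have hlt : u < arrivalTime x n + s n - arrivalTime x 0 := EReal.coe_lt_coe_iff.1 hlt
    rw [← Set.not_nonempty_iff_eq_empty] at hu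
    rcases le_total u t with hut | hut
    · exact hu ((key u hu0).2 (hc u hu0 hut))
    · exact hu ⟨n, by linarith, by linarith⟩
  · intro h
    simp only [Covered, not_forall] at h
    obtain ⟨u, hu0, hut, hu⟩ := h
    rw [← key u hu0, Set.not_nonempty_iff_eq_empty] at hu
    have hle : busyPeriod x s ≤ (u : EReal) := sInf_le ⟨u, ⟨hu0, hu⟩, rfl⟩
    exact hle.trans (EReal.coe_le_coe_iff.2 hut)

theorem stay_nonneg (n : ℕ) (x s : ℕ → ℝ) (r t : ℝ) : 0 ≤ stay n x s r t := by
  induction n generalizing x s r t with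
  | zero => simp only [stay]; split_ifs <;> norm_num
  | succ n ih =>
    simp only [stay]
    refine add_nonneg (by split_ifs <;> norm_num) ?_
    split_ifs
    exacts [ih _ _ _ _, le_rfl]

theorem stay_le_one (n : ℕ) {x s : ℕ → ℝ} (hx : ∀ i, 0 < x i) (r t : ℝ) : stay n x s r t ≤ 1 := by
  induction n generalizing x s r t with
  | zero => simp only [stay]; split_ifs <;> norm_num
  | succ n ih =>
    simp only [stay]
    by_cases htx : t < x 0
    · rw [stay_of_neg n _ _ _ _ (by linarith) fun i => hx (i + 1), ite_self, add_zero]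
      split_ifs <;> norm_num
    · simp only [htx, and_false, if_false, zero_add]
      split_ifs
      exacts [ih (fun i => hx (i + 1)) _ _, zero_le_one]

/-- A crude bound valid for every path, including those with nonpositive interarrival times; it
supplies integrability on the whole product space. -/
theorem abs_stay_le (n : ℕ) (x s : ℕ → ℝ) (r t : ℝ) : |stay n x s r t| ≤ n + 1 := by
  induction n generalizing x s r t with
  | zero => simp only [stay]; split_ifs <;> norm_num
  | succ n ih =>
    simp only [stay]
    refine (abs_add_le _ _).trans ?_
    have h1 : |(if (0 ≤ t ∧ t < r) ∧ t < x 0 then (1 : ℝ) else 0)| ≤ 1 := by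
      split_ifs <;> norm_num
    have h2 : |(if x 0 ≤ r then stay n (fun i => x (i + 1)) (fun i => s (i + 1))
        (max (r - x 0) (s 0)) (t - x 0) else 0)| ≤ n + 1 := by
      split_ifs
      · exact ih _ _ _ _
      · rw [abs_zero]; positivity
    push_cast
    linarith

theorem measurable_stay (n : ℕ) :
    Measurable fun q : ((ℕ → ℝ) × (ℕ → ℝ)) × ℝ × ℝ => stay n q.1.1 q.1.2 q.2.1 q.2.2 := by
  have hr : Measurable fun q : ((ℕ → ℝ) × (ℕ → ℝ)) × ℝ × ℝ => q.2.1 := by fun_prop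
  have ht : Measurable fun q : ((ℕ → ℝ) × (ℕ → ℝ)) × ℝ × ℝ => q.2.2 := by fun_prop
  have hx0 : Measurable fun q : ((ℕ → ℝ) × (ℕ → ℝ)) × ℝ × ℝ => q.1.1 0 := by fun_prop
  have hs0 : Measurable fun q : ((ℕ → ℝ) × (ℕ → ℝ)) × ℝ × ℝ => q.1.2 0 := by fun_prop
  have hb : MeasurableSet {q : ((ℕ → ℝ) × (ℕ → ℝ)) × ℝ × ℝ | 0 ≤ q.2.2 ∧ q.2.2 < q.2.1} :=
    (measurableSet_le measurable_const ht).inter (measurableSet_lt ht hr)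
  induction n with
  | zero => exact Measurable.ite hb measurable_const measurable_const
  | succ n ih =>
    simp only [stay]
    refine Measurable.add (Measurable.ite (hb.inter (measurableSet_lt ht hx0)) measurable_const
      measurable_const) (Measurable.ite (measurableSet_le hx0 hr) ?_ measurable_const)
    have hx : Measurable fun q : ((ℕ → ℝ) × (ℕ → ℝ)) × ℝ × ℝ => fun i : ℕ => q.1.1 (i + 1) := by
      fun_prop
    have hs : Measurable fun q : ((ℕ → ℝ) × (ℕ → ℝ)) × ℝ × ℝ => fun i : ℕ => q.1.2 (i + 1) := by
      fun_prop
    exact ih.comp ((hx.prodMk hs).prodMk (((hr.sub hx0).max hs0).prodMk (ht.sub hx0)))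

/-! ### The probability of an empty system -/

/-- The probability that a system empty at time `0` is empty at time `t`. -/
def vac (lam : ℝ) (ν : Measure ℝ) (t : ℝ) : ℝ :=
  Real.exp (-(lam * ∫ x in (0 : ℝ)..t, (1 - cdf ν x)))

/-- The density of the age, at a given time, of the most recent arrival still in the system. -/
def lastDensity (lam : ℝ) (ν : Measure ℝ) (w : ℝ) : ℝ := lam * (1 - cdf ν w) * vac lam ν w

/-- The measure on `(0, ∞)` with density `lastDensity`. -/
def lastMeasure (lam : ℝ) (ν : Measure ℝ) : Measure ℝ :=
  (volume.restrict (Set.Ioi 0)).withDensity fun w => ENNReal.ofReal (lastDensity lam ν w)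

section

variable (ν : Measure ℝ)

theorem antitone_one_sub_cdf : Antitone fun x => 1 - cdf ν x := fun a b h => by
  have := monotone_cdf ν h
  simp only; linarith

theorem one_sub_cdf_nonneg (x : ℝ) : 0 ≤ 1 - cdf ν x := sub_nonneg.2 (cdf_le_one ν x)

theorem one_sub_cdf_le_one (x : ℝ) : 1 - cdf ν x ≤ 1 := by linarith [cdf_nonneg ν x]

theorem measurable_cdf : Measurable (cdf ν) := (monotone_cdf ν).measurable

theorem intervalIntegrable_one_sub_cdf (a b : ℝ) :
    IntervalIntegrable (fun x => 1 - cdf ν x) volume a b :=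
  (antitone_one_sub_cdf ν).intervalIntegrable

theorem continuous_integral_one_sub_cdf :
    Continuous fun t => ∫ x in (0 : ℝ)..t, (1 - cdf ν x) :=
  intervalIntegral.continuous_primitive (fun a b => intervalIntegrable_one_sub_cdf ν a b) 0

theorem hasDerivWithinAt_integral_one_sub_cdf (t : ℝ) :
    HasDerivWithinAt (fun t => ∫ x in (0 : ℝ)..t, (1 - cdf ν x)) (1 - cdf ν t) (Set.Ioi t) t := by
  have hc : ContinuousWithinAt (fun x => 1 - cdf ν x) (Set.Ici t) t :=
    continuousWithinAt_const.sub ((cdf ν).right_continuous t)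
  exact (intervalIntegral.integral_hasDerivWithinAt_right (s := Set.Ici t) (t := Set.Ioi t)
    (intervalIntegrable_one_sub_cdf ν 0 t)
    (antitone_one_sub_cdf ν).measurable.stronglyMeasurable.stronglyMeasurableAtFilter
    (hc.mono Set.Ioi_subset_Ici_self)).mono Set.Ioi_subset_Ici_self

theorem continuous_vac (lam : ℝ) : Continuous (vac lam ν) :=
  Real.continuous_exp.comp ((continuous_integral_one_sub_cdf ν).const_mul lam).neg

theorem vac_pos (lam t : ℝ) : 0 < vac lam ν t := Real.exp_pos _

theorem vac_zero (lam : ℝ) : vac lam ν 0 = 1 := by simp [vac]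

theorem vac_le_one {lam t : ℝ} (hlam : 0 < lam) (ht : 0 ≤ t) : vac lam ν t ≤ 1 := by
  have := intervalIntegral.integral_nonneg (μ := volume) ht fun x _ => one_sub_cdf_nonneg ν x
  exact Real.exp_le_one_iff.2 (neg_nonpos.2 (by positivity))

theorem measurable_lastDensity (lam : ℝ) : Measurable (lastDensity lam ν) :=
  ((measurable_const.sub (measurable_cdf ν)).const_mul lam).mul (continuous_vac ν lam).measurable

theorem lastDensity_nonneg {lam : ℝ} (hlam : 0 < lam) (w : ℝ) : 0 ≤ lastDensity lam ν w :=
  mul_nonneg (mul_nonneg hlam.le (one_sub_cdf_nonneg ν w)) (vac_pos ν lam w).le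

/-- First-arrival equation for an initially empty system: it is empty at t if nobody has come, or if
the first customer has left and the later ones have too. Analytically, the integrand, after x = t -
y, is the right derivative of e^{-λ(t-y)} `vac`(y); right derivatives suffice, so jumps of G do no
harm. -/
theorem vac_renewal (lam t : ℝ) :
    Real.exp (-(lam * t)) +
        ∫ x in (0 : ℝ)..t, lam * Real.exp (-(lam * x)) * (vac lam ν (t - x) * cdf ν (t - x)) =
      vac lam ν t := by
  have hd : ∀ y, HasDerivWithinAt (fun y => Real.exp (-(lam * (t - y))) * vac lam ν y)
      (lam * Real.exp (-(lam * (t - y))) * (vac lam ν y * cdf ν y)) (Set.Ioi y) y := by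
    intro y
    have h1 : HasDerivAt (fun y => -(lam * (t - y))) lam y := by
      refine (((hasDerivAt_id y).const_sub t).const_mul lam).neg.congr_deriv ?_
      simp
    have h2 := ((hasDerivWithinAt_integral_one_sub_cdf ν y).const_mul lam).neg.exp
    have h3 := h1.exp.hasDerivWithinAt.mul h2
    refine h3.congr_deriv ?_
    simp only [vac, Pi.neg_apply]
    ring
  have hcont : Continuous fun y => Real.exp (-(lam * (t - y))) * vac lam ν y :=
    (by fun_prop : Continuous fun y => Real.exp (-(lam * (t - y)))).mul (continuous_vac ν lam)
  have hint : IntervalIntegrable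
      (fun y => lam * Real.exp (-(lam * (t - y))) * (vac lam ν y * cdf ν y)) volume 0 t :=
    (((monotone_cdf ν).intervalIntegrable).continuousOn_mul
      (continuous_vac ν lam).continuousOn).continuousOn_mul
      (by fun_prop : Continuous fun y => lam * Real.exp (-(lam * (t - y)))).continuousOn
  have key := intervalIntegral.integral_eq_sub_of_hasDeriv_right hcont.continuousOn
    (fun x _ => hd x) hint
  have hsub := intervalIntegral.integral_comp_sub_left (a := 0) (b := t)
    (fun y => lam * Real.exp (-(lam * (t - y))) * (vac lam ν y * cdf ν y)) t
  simp only [sub_sub_cancel, sub_self, sub_zero] at hsub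
  rw [hsub, key]
  simp [vac_zero]

theorem integral_lastMeasure {lam : ℝ} (hlam : 0 < lam) (f : ℝ → ℝ) :
    ∫ w, f w ∂lastMeasure lam ν = ∫ w in Set.Ioi 0, lastDensity lam ν w * f w := by
  rw [lastMeasure, integral_withDensity_eq_integral_toReal_smul
    (measurable_lastDensity ν lam).ennreal_ofReal (ae_of_all _ fun _ => ENNReal.ofReal_lt_top)]
  simp only [ENNReal.toReal_ofReal (lastDensity_nonneg ν hlam _), smul_eq_mul]

theorem ae_lastMeasure_pos (lam : ℝ) : ∀ᵐ w ∂lastMeasure lam ν, 0 < w :=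
  (withDensity_absolutelyContinuous _ _).ae_le (ae_restrict_mem measurableSet_Ioi)

theorem one_sub_cdf_eq_real [IsProbabilityMeasure ν] (x : ℝ) : 1 - cdf ν x = ν.real (Set.Ioi x) := by
  rw [cdf_eq_real, ← probReal_compl_eq_one_sub measurableSet_Iic, Set.compl_Iic]

variable {ν}

theorem ae_nonneg_of_measure_Iio (h0 : ν (Set.Iio 0) = 0) : ∀ᵐ x ∂ν, 0 ≤ x := by
  rw [ae_iff]; simpa [Set.Iio] using h0

variable [IsProbabilityMeasure ν]

/-- Dropping the factor `vac` ≤ 1 leaves λ∫(1 - G), which is λ times the mean service time by the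
layer-cake formula. -/
theorem isFiniteMeasure_lastMeasure {lam : ℝ} (hlam : 0 < lam) (h0 : ν (Set.Iio 0) = 0)
    (hint : Integrable (fun x : ℝ => x) ν) : IsFiniteMeasure (lastMeasure lam ν) := by
  constructor
  rw [lastMeasure, withDensity_apply _ MeasurableSet.univ, Measure.restrict_univ]
  have h1 : ∫⁻ w in Set.Ioi 0, ENNReal.ofReal (lastDensity lam ν w) ≤
      ∫⁻ w in Set.Ioi 0, ENNReal.ofReal lam * ν {x | w < x} := by
    refine setLIntegral_mono' measurableSet_Ioi fun w hw => ?_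
    change _ ≤ ENNReal.ofReal lam * ν (Set.Ioi w)
    rw [← ofReal_measureReal, ← ENNReal.ofReal_mul hlam.le, ← one_sub_cdf_eq_real]
    exact ENNReal.ofReal_le_ofReal (mul_le_of_le_one_right
      (mul_nonneg hlam.le (one_sub_cdf_nonneg ν w)) (vac_le_one ν hlam (le_of_lt hw)))
  refine h1.trans_lt ?_
  rw [lintegral_const_mul' _ _ ENNReal.ofReal_ne_top,
    ← lintegral_eq_lintegral_meas_lt ν (ae_nonneg_of_measure_Iio h0) hint.aemeasurable]
  exact ENNReal.mul_lt_top ENNReal.ofReal_lt_top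
    ((hasFiniteIntegral_iff_ofReal (ae_nonneg_of_measure_Iio h0)).1 hint.2)

/-- Layer-cake formula again; this is what bounds `vac` below by e^{-ρ}. -/
theorem integral_one_sub_cdf_le_meanService (h0 : ν (Set.Iio 0) = 0)
    (hint : Integrable (fun x : ℝ => x) ν) {t : ℝ} (ht : 0 ≤ t) :
    ∫ x in (0 : ℝ)..t, (1 - cdf ν x) ≤ meanService ν := by
  rw [meanService, integral_eq_lintegral_of_nonneg_ae (ae_nonneg_of_measure_Iio h0) hint.1,
    lintegral_eq_lintegral_meas_lt ν (ae_nonneg_of_measure_Iio h0) hint.aemeasurable,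
    intervalIntegral.integral_of_le ht, integral_eq_lintegral_of_nonneg_ae
      (ae_of_all _ fun x => one_sub_cdf_nonneg ν x)
      (antitone_one_sub_cdf ν).measurable.aestronglyMeasurable]
  refine ENNReal.toReal_mono ?_ ?_
  · rw [← lintegral_eq_lintegral_meas_lt ν (ae_nonneg_of_measure_Iio h0) hint.aemeasurable]
    exact ((hasFiniteIntegral_iff_ofReal (ae_nonneg_of_measure_Iio h0)).1 hint.2).ne
  · have h : ∀ x, ENNReal.ofReal (1 - cdf ν x) = ν {a | x < a} := fun x => by
      rw [one_sub_cdf_eq_real, ofReal_measureReal]; rfl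
    simp only [h]
    exact lintegral_mono_set Set.Ioc_subset_Ioi_self

end

/-! ### The exponential law -/

section

variable {lam : ℝ}

theorem integral_expMeasure (hlam : 0 < lam) (f : ℝ → ℝ) :
    ∫ x, f x ∂expMeasure lam = ∫ x in Set.Ioi 0, lam * Real.exp (-(lam * x)) * f x := by
  have h : expMeasure lam =
      volume.withDensity fun x => ENNReal.ofReal (exponentialPDFReal lam x) := rfl
  rw [h, integral_withDensity_eq_integral_toReal_smul
    (measurable_exponentialPDFReal lam).ennreal_ofReal
    (ae_of_all _ fun _ => ENNReal.ofReal_lt_top), ← integral_Ici_eq_integral_Ioi,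
    ← integral_indicator measurableSet_Ici]
  congr 1 with x
  rw [← exponentialPDF, exponentialPDF_eq]
  by_cases hx : 0 ≤ x
  · rw [if_pos hx, Set.indicator_of_mem (Set.mem_Ici.2 hx),
      ENNReal.toReal_ofReal (by positivity), smul_eq_mul]
  · rw [if_neg hx, Set.indicator_of_notMem (by simpa using hx)]
    simp

theorem ae_expMeasure_pos (lam : ℝ) : ∀ᵐ x ∂expMeasure lam, 0 < x := by
  have h : expMeasure lam =
      volume.withDensity fun x => ENNReal.ofReal (exponentialPDFReal lam x) := rfl
  rw [h, ae_withDensity_iff (measurable_exponentialPDFReal lam).ennreal_ofReal]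
  -- The density does not vanish at 0, so that point is discarded as a Lebesgue null set.
  have h0 : ∀ᵐ x : ℝ, x ≠ 0 := by simp [ae_iff]
  filter_upwards [h0] with x hx hpdf
  by_contra! hneg
  exact hpdf (exponentialPDF_of_neg (lt_of_le_of_ne hneg hx))

theorem integral_exp_neg_expMeasure (hlam : 0 < lam) : ∫ x, Real.exp (-(lam * x)) ∂expMeasure lam = 1 / 2 := by
  rw [integral_expMeasure hlam]
  have : ∀ x : ℝ, lam * Real.exp (-(lam * x)) * Real.exp (-(lam * x)) =
      lam * Real.exp ((-(2 * lam)) * x) := fun x => by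
    rw [mul_assoc, ← Real.exp_add]; ring_nf
  simp only [this]
  rw [integral_const_mul, integral_exp_mul_Ioi (by linarith)]
  simp
  field_simp

theorem integrable_exp_neg_expMeasure (hlam : 0 < lam) :
    Integrable (fun x => Real.exp (-(lam * x))) (expMeasure lam) := by
  -- A nonintegrable function would have integral 0 by convention, not 1/2.
  by_contra h
  have := integral_exp_neg_expMeasure hlam
  rw [integral_undef h] at this
  norm_num at this

theorem expMeasure_real_Ioi (hlam : 0 < lam) {t : ℝ} (ht : 0 ≤ t) :
    (expMeasure lam).real (Set.Ioi t) = Real.exp (-(lam * t)) := by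
  have := isProbabilityMeasure_expMeasure hlam
  rw [← one_sub_cdf_eq_real, cdf_expMeasure_eq hlam, if_pos ht]
  ring

end

/-! ### The first-arrival operator and the last-arrival convolution -/

/-- Bounded, jointly measurable functions of the residual work and the time. -/
def BddMeas (U : ℝ → ℝ → ℝ) : Prop :=
  Measurable (Function.uncurry U) ∧ ∃ C, ∀ r t, |U r t| ≤ C

/-- The integrand of `firstArrival`: the first arrival is at `y.1`, with service time `y.2`. -/
def arrivalKernel (U : ℝ → ℝ → ℝ) (r t : ℝ) (y : ℝ × ℝ) : ℝ :=
  if y.1 ≤ r then U (max (r - y.1) y.2) (t - y.1) else 0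

/-- Expected value of `U` just after the first arrival, on the event that it finds the system
nonempty. -/
def firstArrival (lam : ℝ) (ν : Measure ℝ) (U : ℝ → ℝ → ℝ) (r t : ℝ) : ℝ :=
  ∫ y, arrivalKernel U r t y ∂(expMeasure lam).prod ν

/-- Convolution with `lastMeasure` in the time variable. -/
def lastConv (lam : ℝ) (ν : Measure ℝ) (U : ℝ → ℝ → ℝ) (r t : ℝ) : ℝ :=
  ∫ w, U r (t - w) ∂lastMeasure lam ν

/-- Indicator that a system with residual work `r` and no arrivals is busy on `[0, t]`. -/
def stay₀ (r t : ℝ) : ℝ := if 0 ≤ t ∧ t < r then 1 else 0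

/-- The probability that a system with residual work `r`, fed by `n` arrivals only, is busy on
`[0, t]`. -/
def stayProb (lam : ℝ) (ν : Measure ℝ) : ℕ → ℝ → ℝ → ℝ
  | 0 => stay₀
  | n + 1 => fun r t => stay₀ r t * Real.exp (-(lam * t)) + firstArrival lam ν (stayProb lam ν n) r t

theorem measurable_stay₀ : Measurable (Function.uncurry stay₀) :=
  Measurable.ite ((measurableSet_le measurable_const measurable_snd).inter
    (measurableSet_lt measurable_snd measurable_fst)) measurable_const measurable_const

theorem stay₀_of_neg {r t : ℝ} (ht : t < 0) : stay₀ r t = 0 := by simp [stay₀, not_le.2 ht]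

theorem stay₀_nonneg (r t : ℝ) : 0 ≤ stay₀ r t := by
  unfold stay₀; split_ifs <;> norm_num

theorem stay₀_le_one (r t : ℝ) : stay₀ r t ≤ 1 := by
  unfold stay₀; split_ifs <;> norm_num

theorem BddMeas.stay₀_mul {q : ℝ → ℝ} (hq : Measurable q) (h0 : ∀ t, 0 ≤ t → |q t| ≤ 1) :
    BddMeas fun r t => stay₀ r t * q t := by
  refine ⟨measurable_stay₀.mul (hq.comp measurable_snd), 1, fun r t => ?_⟩
  by_cases ht : 0 ≤ t
  · rw [abs_mul, abs_of_nonneg (stay₀_nonneg r t)]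
    exact mul_le_one₀ (stay₀_le_one r t) (abs_nonneg _) (h0 t ht)
  · simp [stay₀_of_neg (not_le.1 ht)]

section

variable {U W : ℝ → ℝ → ℝ}

theorem BddMeas.sub (hU : BddMeas U) (hW : BddMeas W) : BddMeas fun r t => U r t - W r t := by
  obtain ⟨hU, C, hC⟩ := hU
  obtain ⟨hW, D, hD⟩ := hW
  exact ⟨hU.sub hW, C + D, fun r t => (abs_sub _ _).trans (add_le_add (hC r t) (hD r t))⟩

theorem BddMeas.add (hU : BddMeas U) (hW : BddMeas W) : BddMeas fun r t => U r t + W r t := by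
  obtain ⟨hU, C, hC⟩ := hU
  obtain ⟨hW, D, hD⟩ := hW
  exact ⟨hU.add hW, C + D, fun r t => (abs_add_le _ _).trans (add_le_add (hC r t) (hD r t))⟩

theorem BddMeas.measurable_arrivalKernel (hU : BddMeas U) :
    Measurable fun q : (ℝ × ℝ) × ℝ × ℝ => arrivalKernel U q.1.1 q.1.2 q.2 := by
  have h1 : Measurable fun q : (ℝ × ℝ) × ℝ × ℝ => q.2.1 := by fun_prop
  have h2 : Measurable fun q : (ℝ × ℝ) × ℝ × ℝ => q.1.1 := by fun_prop
  refine Measurable.ite (measurableSet_le h1 h2) ?_ measurable_const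
  exact hU.1.comp (by fun_prop : Measurable fun q : (ℝ × ℝ) × ℝ × ℝ =>
    (max (q.1.1 - q.2.1) q.2.2, q.1.2 - q.2.1))

theorem abs_arrivalKernel_le {C : ℝ} (hC : ∀ r t, |U r t| ≤ C) (r t : ℝ) (y : ℝ × ℝ) :
    |arrivalKernel U r t y| ≤ C := by
  unfold arrivalKernel
  split_ifs
  · exact hC _ _
  · rw [abs_zero]; exact (abs_nonneg _).trans (hC 0 0)

theorem arrivalKernel_sub (r t : ℝ) (y : ℝ × ℝ) :
    arrivalKernel (fun r t => U r t - W r t) r t y =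
      arrivalKernel U r t y - arrivalKernel W r t y := by
  unfold arrivalKernel; split_ifs <;> simp

variable {lam : ℝ} {ν : Measure ℝ}

theorem BddMeas.integrable_lastConv [IsFiniteMeasure (lastMeasure lam ν)] (hU : BddMeas U)
    (r t : ℝ) : Integrable (fun w => U r (t - w)) (lastMeasure lam ν) := by
  obtain ⟨hU, C, hC⟩ := hU
  exact .of_bound (hU.comp (by fun_prop : Measurable fun w : ℝ => (r, t - w))).aestronglyMeasurable
    C (ae_of_all _ fun w => hC _ _)

theorem BddMeas.lastConv [IsFiniteMeasure (lastMeasure lam ν)] (hU : BddMeas U) :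
    BddMeas (lastConv lam ν U) := by
  obtain ⟨hU, C, hC⟩ := hU
  refine ⟨(StronglyMeasurable.integral_prod_right'
    (f := fun q : (ℝ × ℝ) × ℝ => U q.1.1 (q.1.2 - q.2)) (hU.comp (by fun_prop :
      Measurable fun q : (ℝ × ℝ) × ℝ => (q.1.1, q.1.2 - q.2))).stronglyMeasurable).measurable,
    C * (lastMeasure lam ν).real Set.univ, fun r t => ?_⟩
  exact norm_integral_le_of_norm_le_const (f := fun w => U r (t - w)) (ae_of_all _ fun w => hC _ _)

theorem lastConv_add [IsFiniteMeasure (lastMeasure lam ν)] (hU : BddMeas U) (hW : BddMeas W)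
    (r t : ℝ) : MGInf.lastConv lam ν (fun r t => U r t + W r t) r t =
      MGInf.lastConv lam ν U r t + MGInf.lastConv lam ν W r t :=
  integral_add (hU.integrable_lastConv r t) (hW.integrable_lastConv r t)

theorem lastConv_of_neg (hU : ∀ r t, t < 0 → U r t = 0) {r t : ℝ} (ht : t < 0) :
    lastConv lam ν U r t = 0 := by
  refine integral_eq_zero_of_ae ?_
  filter_upwards [ae_lastMeasure_pos ν lam] with w hw
  exact hU _ _ (by linarith)

theorem ae_fst_pos : ∀ᵐ y ∂(expMeasure lam).prod ν, 0 < y.1 :=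
  Measure.quasiMeasurePreserving_fst.ae (ae_expMeasure_pos lam)

theorem firstArrival_of_neg (hU : ∀ r t, t < 0 → U r t = 0) {r t : ℝ} (ht : t < 0) :
    firstArrival lam ν U r t = 0 := by
  refine integral_eq_zero_of_ae ?_
  filter_upwards [ae_fst_pos] with y hy
  simp [arrivalKernel, hU _ _ (by linarith : t - y.1 < 0)]

variable [IsProbabilityMeasure (expMeasure lam)] [IsProbabilityMeasure ν]

theorem BddMeas.integrable_arrivalKernel (hU : BddMeas U) (r t : ℝ) :
    Integrable (arrivalKernel U r t) ((expMeasure lam).prod ν) := by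
  have hm := hU.measurable_arrivalKernel
  obtain ⟨hU, C, hC⟩ := hU
  exact .of_bound (hm.comp (by fun_prop :
      Measurable fun y : ℝ × ℝ => ((r, t), y))).aestronglyMeasurable
    C (ae_of_all _ fun w => abs_arrivalKernel_le hC _ _ _)

theorem BddMeas.firstArrival (hU : BddMeas U) : BddMeas (firstArrival lam ν U) := by
  have hm := hU.measurable_arrivalKernel
  obtain ⟨hU, C, hC⟩ := hU
  refine ⟨(StronglyMeasurable.integral_prod_right' hm.stronglyMeasurable).measurable, C,
    fun r t => ?_⟩
  refine (norm_integral_le_of_norm_le_const (f := arrivalKernel U r t)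
    (ae_of_all _ fun w => abs_arrivalKernel_le hC r t w)).trans ?_
  simp

theorem firstArrival_sub (hU : BddMeas U) (hW : BddMeas W) (r t : ℝ) :
    MGInf.firstArrival lam ν (fun r t => U r t - W r t) r t =
      MGInf.firstArrival lam ν U r t - MGInf.firstArrival lam ν W r t := by
  simp only [MGInf.firstArrival, arrivalKernel_sub]
  exact integral_sub (hU.integrable_arrivalKernel r t) (hW.integrable_arrivalKernel r t)

/-- Convolution only shifts the time variable, and so commutes with the kernel of the first arrival;
Fubini does the rest. -/
theorem firstArrival_lastConv [IsFiniteMeasure (lastMeasure lam ν)] (hU : BddMeas U) (r t : ℝ) :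
    firstArrival lam ν (lastConv lam ν U) r t = lastConv lam ν (firstArrival lam ν U) r t := by
  have h1 : ∀ y, arrivalKernel (lastConv lam ν U) r t y =
      ∫ w, arrivalKernel U r (t - w) y ∂lastMeasure lam ν := by
    intro y
    simp only [arrivalKernel, lastConv]
    split_ifs
    · simp only [sub_right_comm]
    · simp
  simp only [firstArrival, h1]
  rw [integral_integral_swap]
  · rfl
  · have hm := hU.measurable_arrivalKernel
    obtain ⟨hU, C, hC⟩ := hU
    exact .of_bound (hm.comp (by fun_prop : Measurable fun q : (ℝ × ℝ) × ℝ =>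
      ((r, t - q.2), q.1))).aestronglyMeasurable C (ae_of_all _ fun q => abs_arrivalKernel_le hC _ _ _)

/-- The first arrival shifts time back by an exponential variable X, so the weight e^{λt} gains the
factor E e^{-λX} = 1/2. -/
theorem abs_firstArrival_le (hlam : 0 < lam) {C : ℝ}
    (hC : ∀ r t, |U r t| ≤ C * Real.exp (lam * t)) (r t : ℝ) :
    |firstArrival lam ν U r t| ≤ C / 2 * Real.exp (lam * t) := by
  have hC0 : 0 ≤ C := by
    have := (abs_nonneg _).trans (hC 0 0)
    simpa using this
  have hi : Integrable (fun y : ℝ × ℝ => Real.exp (-(lam * y.1))) ((expMeasure lam).prod ν) :=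
    (integrable_exp_neg_expMeasure hlam).comp_fst ν
  have h1 : ∫ y, Real.exp (-(lam * y.1)) ∂(expMeasure lam).prod ν = 1 / 2 := by
    rw [← integral_exp_neg_expMeasure hlam]
    simpa using integral_fun_fst (μ := expMeasure lam) (ν := ν) fun x => Real.exp (-(lam * x))
  calc |firstArrival lam ν U r t|
      ≤ ∫ y, C * Real.exp (lam * t) * Real.exp (-(lam * y.1)) ∂(expMeasure lam).prod ν := by
        refine norm_integral_le_of_norm_le (f := arrivalKernel U r t) (hi.const_mul _)
          (ae_of_all _ fun y => ?_)
        rw [Real.norm_eq_abs]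
        unfold arrivalKernel
        split_ifs
        · refine (hC _ _).trans_eq ?_
          rw [mul_assoc, ← Real.exp_add]
          ring_nf
        · rw [abs_zero]; positivity
    _ = C / 2 * Real.exp (lam * t) := by rw [integral_const_mul, h1]; ring

end

/-! ### Source terms and the defect in the last-arrival equation -/

section

variable {lam : ℝ} {ν : Measure ℝ}

theorem BddMeas.stay₀_mul_exp (hlam : 0 < lam) :
    BddMeas fun r t => stay₀ r t * Real.exp (-(lam * t)) :=
  .stay₀_mul (by fun_prop) fun t ht => by
    rw [Real.abs_exp]; exact Real.exp_le_one_iff.2 (neg_nonpos.2 (by positivity))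

theorem BddMeas.stay₀_mul_vac (ν : Measure ℝ) (hlam : 0 < lam) :
    BddMeas fun r t => stay₀ r t * vac lam ν t :=
  .stay₀_mul (continuous_vac ν lam).measurable fun t ht => by
    rw [abs_of_pos (vac_pos ν lam t)]; exact vac_le_one ν hlam ht

theorem lastConv_stay₀_mul_exp (hlam : 0 < lam) (r t : ℝ) :
    lastConv lam ν (fun r t => stay₀ r t * Real.exp (-(lam * t))) r t =
      ∫ x in Set.Ico 0 (min r t),
        lam * Real.exp (-(lam * x)) * (vac lam ν (t - x) * (1 - cdf ν (t - x))) := by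
  rw [lastConv, integral_lastMeasure ν hlam, ← integral_indicator measurableSet_Ioi,
    ← integral_sub_left_eq_self _ volume t, ← integral_indicator measurableSet_Ico]
  congr 1 with x
  simp only [Set.indicator_apply, Set.mem_Ioi, Set.mem_Ico, sub_pos, sub_sub_cancel, lt_min_iff,
    stay₀, lastDensity]
  by_cases h1 : x < t <;> by_cases h2 : 0 ≤ x <;> by_cases h3 : x < r <;> simp [h1, h2, h3]
  ring

/-- After an arrival at x, work remains at time t exactly when the initial work lasts beyond t or
the new service time exceeds t - x. -/
theorem integral_service_arrivalKernel [IsProbabilityMeasure ν] (r t x : ℝ) :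
    ∫ s, arrivalKernel (fun r t => stay₀ r t * vac lam ν t) r t (x, s) ∂ν =
      if x ≤ r ∧ x ≤ t then vac lam ν (t - x) * (if t < r then 1 else 1 - cdf ν (t - x)) else 0 := by
  by_cases hxr : x ≤ r
  swap
  · simp [arrivalKernel, hxr]
  by_cases hxt : x ≤ t
  swap
  · simp [arrivalKernel, hxt, stay₀]
  simp only [arrivalKernel, hxr, hxt, if_true, and_self, stay₀, sub_nonneg, true_and]
  rw [integral_mul_const, mul_comm]
  congr 1
  split_ifs with htr
  · simp [htr]
  · have : ∀ s, (t - x < max (r - x) s) ↔ s ∈ Set.Ioi (t - x) := fun s => by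
      rw [lt_max_iff, Set.mem_Ioi]
      exact or_iff_right (by linarith)
    simp only [this]
    rw [one_sub_cdf_eq_real, ← integral_indicator_one measurableSet_Ioi]
    rfl

theorem stayProb_of_neg (n : ℕ) (r t : ℝ) (ht : t < 0) : stayProb lam ν n r t = 0 := by
  induction n generalizing r t with
  | zero => exact stay₀_of_neg ht
  | succ n ih => simp [stayProb, stay₀_of_neg ht, firstArrival_of_neg ih ht]

variable [IsProbabilityMeasure (expMeasure lam)] [IsProbabilityMeasure ν]

theorem bddMeas_stayProb (hlam : 0 < lam) (n : ℕ) : BddMeas (stayProb lam ν n) := by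
  induction n with
  | zero =>
    refine ⟨measurable_stay₀, 1, fun r t => ?_⟩
    rw [stayProb, abs_of_nonneg (stay₀_nonneg r t)]; exact stay₀_le_one r t
  | succ n ih => exact (BddMeas.stay₀_mul_exp hlam).add ih.firstArrival

theorem firstArrival_stay₀_mul_vac (hlam : 0 < lam) (r t : ℝ) :
    firstArrival lam ν (fun r t => stay₀ r t * vac lam ν t) r t =
      ∫ x in Set.Ioc 0 (min r t), lam * Real.exp (-(lam * x)) *
        (vac lam ν (t - x) * (if t < r then 1 else 1 - cdf ν (t - x))) := by
  rw [firstArrival, integral_prod _ ((BddMeas.stay₀_mul_vac ν hlam).integrable_arrivalKernel r t),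
    integral_expMeasure hlam, ← integral_indicator measurableSet_Ioi,
    ← integral_indicator measurableSet_Ioc]
  congr 1 with x
  by_cases hx : 0 < x
  · simp only [Set.indicator_apply, Set.mem_Ioi, Set.mem_Ioc, hx, le_min_iff, true_and, if_true]
    rw [integral_service_arrivalKernel, mul_ite, mul_zero]
  · simp [hx]

/-- The source terms of the first-arrival and the last-arrival equations are compatible. -/
theorem firstArrival_vac_add (hlam : 0 < lam) (r t : ℝ) :
    firstArrival lam ν (fun r t => stay₀ r t * vac lam ν t) r t +
        stay₀ r t * Real.exp (-(lam * t)) =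
      stay₀ r t * vac lam ν t +
        lastConv lam ν (fun r t => stay₀ r t * Real.exp (-(lam * t))) r t := by
  rw [firstArrival_stay₀_mul_vac hlam, lastConv_stay₀_mul_exp hlam,
    ← restrict_Ioo_eq_restrict_Ico, restrict_Ioo_eq_restrict_Ioc]
  by_cases htr : t < r
  swap
  -- If r ≤ t, the terms with `stay₀` vanish and the two remaining integrals coincide; only t < r
  -- needs `vac_renewal`.
  · simp [stay₀, htr]
  by_cases ht : 0 ≤ t
  swap
  · rw [Set.Ioc_eq_empty (by simp; intro _; linarith)]
    simp [stay₀, ht]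
  rw [min_eq_right htr.le, ← intervalIntegral.integral_of_le ht,
    ← intervalIntegral.integral_of_le ht]
  have hv : Continuous fun x => vac lam ν (t - x) :=
    (continuous_vac ν lam).comp (continuous_const.sub continuous_id)
  have he : Continuous fun x => lam * Real.exp (-(lam * x)) := by fun_prop
  have hm : Antitone fun x => cdf ν (t - x) := fun a b h => monotone_cdf ν (by linarith)
  have hsub : ∫ x in (0 : ℝ)..t, lam * Real.exp (-(lam * x)) * (vac lam ν (t - x) * cdf ν (t - x)) =
      (∫ x in (0 : ℝ)..t, lam * Real.exp (-(lam * x)) * (vac lam ν (t - x) * 1)) -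
      ∫ x in (0 : ℝ)..t, lam * Real.exp (-(lam * x)) * (vac lam ν (t - x) * (1 - cdf ν (t - x))) := by
    rw [← intervalIntegral.integral_sub]
    · congr 1 with x; ring
    · exact (he.mul (hv.mul continuous_const)).intervalIntegrable _ _
    · have : IntervalIntegrable (fun x => 1 - cdf ν (t - x)) volume 0 t :=
        intervalIntegrable_const.sub hm.intervalIntegrable
      exact (this.continuousOn_mul hv.continuousOn).continuousOn_mul he.continuousOn
  have hr := vac_renewal ν lam t
  simp only [stay₀, ht, htr, and_self, if_true, one_mul]
  rw [hsub] at hr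
  linarith

/-- The defect of `stayProb` in the last-arrival equation. -/
def lastDefect (lam : ℝ) (ν : Measure ℝ) (n : ℕ) (r t : ℝ) : ℝ :=
  stayProb lam ν n r t - stay₀ r t * vac lam ν t - lastConv lam ν (stayProb lam ν n) r t

/-- Linearity, commutation of the two operators and compatibility of the sources cancel everything
except the image of the previous defect. -/
theorem lastDefect_succ [IsFiniteMeasure (lastMeasure lam ν)] (hlam : 0 < lam) (n : ℕ) (r t : ℝ) :
    lastDefect lam ν (n + 1) r t = firstArrival lam ν (lastDefect lam ν n) r t := by
  have hV := bddMeas_stayProb (ν := ν) hlam n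
  have hψ := BddMeas.stay₀_mul_vac ν hlam
  have e1 : firstArrival lam ν (lastDefect lam ν n) r t = _ :=
    firstArrival_sub (hV.sub hψ) hV.lastConv r t
  have e2 : lastConv lam ν (stayProb lam ν (n + 1)) r t = _ :=
    lastConv_add (BddMeas.stay₀_mul_exp hlam) hV.firstArrival r t
  rw [e1, firstArrival_sub hV hψ, firstArrival_lastConv hV, lastDefect, e2, stayProb]
  linarith [firstArrival_vac_add (ν := ν) hlam r t]

theorem exists_abs_lastDefect_le [IsFiniteMeasure (lastMeasure lam ν)] (hlam : 0 < lam) :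
    ∃ C, ∀ n r t, |lastDefect lam ν n r t| ≤ C / 2 ^ n * Real.exp (lam * t) := by
  have hV := bddMeas_stayProb (ν := ν) hlam 0
  obtain ⟨C, hC⟩ := ((hV.sub (BddMeas.stay₀_mul_vac ν hlam)).sub
    (hV.lastConv (lam := lam) (ν := ν))).2
  have hC0 : 0 ≤ C := (abs_nonneg _).trans (hC 0 0)
  refine ⟨C, fun n => ?_⟩
  induction n with
  | zero =>
    intro r t
    -- A uniform bound is dominated by the weight only for t ≥ 0; for t < 0 the defect is zero.
    by_cases ht : 0 ≤ t
    · refine (hC r t).trans ?_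
      have := Real.one_le_exp (mul_nonneg hlam.le ht)
      simpa using le_mul_of_one_le_right hC0 this
    · rw [not_le] at ht
      rw [lastDefect, stayProb_of_neg _ _ _ ht, stay₀_of_neg ht,
        lastConv_of_neg (stayProb_of_neg 0) ht]
      simp only [zero_mul, sub_zero, abs_zero]
      positivity
  | succ n ih =>
    intro r t
    rw [lastDefect_succ hlam, pow_succ, ← div_div]
    exact abs_firstArrival_le hlam ih r t

end

/-! ### The law of the busy period -/

theorem integral_comp_prodMk_of_indepFun {Ω α β : Type*} [MeasurableSpace Ω] [MeasurableSpace α]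
    [MeasurableSpace β] {P : Measure Ω} [IsProbabilityMeasure P] {Y : Ω → α} {Z : Ω → β}
    (hY : Measurable Y) (hZ : Measurable Z) (h : IndepFun Y Z P) {F : α × β → ℝ}
    (hF : Measurable F) {C : ℝ} (hC : ∀ q, |F q| ≤ C) :
    ∫ ω, F (Y ω, Z ω) ∂P = ∫ y, ∫ ω, F (y, Z ω) ∂P ∂P.map Y := by
  have : IsProbabilityMeasure (P.map Y) := Measure.isProbabilityMeasure_map hY.aemeasurable
  have : IsProbabilityMeasure (P.map Z) := Measure.isProbabilityMeasure_map hZ.aemeasurable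
  rw [← integral_map (φ := fun ω => (Y ω, Z ω)) (hY.prodMk hZ).aemeasurable
    hF.aestronglyMeasurable,
    (indepFun_iff_map_prod_eq_prod_map_map hY.aemeasurable hZ.aemeasurable).1 h, integral_prod _
    (.of_bound hF.aestronglyMeasurable C (ae_of_all _ hC))]
  congr 1 with y
  exact integral_map hZ.aemeasurable (hF.comp measurable_prodMk_left).aestronglyMeasurable

section

variable {Ω : Type*} [MeasurableSpace Ω] {P : Measure Ω}
  {lam : ℝ} {ν : Measure ℝ} {X S : ℕ → Ω → ℝ}

theorem IsQueue.ae_interarrival_pos (hQ : IsQueue P lam ν X S) : ∀ᵐ ω ∂P, ∀ n, 0 < X n ω :=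
  ae_all_iff.2 fun n => ((hQ.interarrival_law n).ae_iff (p := fun x => 0 < x)
    measurableSet_Ioi.mem).2 (ae_expMeasure_pos lam)

/-- The interarrival and service times of the customers from `k` on. -/
def later (X S : ℕ → Ω → ℝ) (k : ℕ) (ω : Ω) : (ℕ → ℝ) × (ℕ → ℝ) :=
  (fun i => X (i + k) ω, fun i => S (i + k) ω)

theorem measurable_later (hX : ∀ n, Measurable (X n)) (hS : ∀ n, Measurable (S n)) (k : ℕ) :
    Measurable (later X S k) :=
  (measurable_pi_lambda _ fun i => hX (i + k)).prodMk (measurable_pi_lambda _ fun i => hS (i + k))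

/-- The two vectors are measurable with respect to σ-algebras generated by disjoint sets of indices.
-/
theorem IsQueue.indepFun_later (hQ : IsQueue P lam ν X S) (hX : ∀ n, Measurable (X n))
    (hS : ∀ n, Measurable (S n)) (k : ℕ) :
    IndepFun (fun ω => (X k ω, S k ω)) (later X S (k + 1)) P := by
  let m : ℕ ⊕ ℕ → MeasurableSpace Ω := fun i => MeasurableSpace.comap (Sum.elim X S i) inferInstance
  have hm : ∀ i, m i ≤ ‹MeasurableSpace Ω› := by
    rintro (i | i)
    exacts [(hX i).comap_le, (hS i).comap_le]
  let A : Set (ℕ ⊕ ℕ) := {.inl k, .inr k}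
  have hle : ∀ (B : Set (ℕ ⊕ ℕ)) i, i ∈ B → Measurable[⨆ j ∈ B, m j] (Sum.elim X S i) :=
    fun B i hi => (comap_measurable (Sum.elim X S i)).mono (le_biSup m hi) le_rfl
  have hind := indep_iSup_of_disjoint hm hQ.indep.iIndep (disjoint_compl_right (a := A))
  refine indep_of_indep_of_le_left (indep_of_indep_of_le_right hind ?_) ?_
  · refine Measurable.comap_le ?_
    refine Measurable.prodMk ?_ ?_
    · exact @measurable_pi_lambda Ω ℕ (fun _ => ℝ) (⨆ j ∈ Aᶜ, m j) _ _ fun i => hle Aᶜ (.inl (i + (k + 1)))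
        (by simp [A]; omega)
    · exact @measurable_pi_lambda Ω ℕ (fun _ => ℝ) (⨆ j ∈ Aᶜ, m j) _ _ fun i => hle Aᶜ (.inr (i + (k + 1)))
        (by simp [A]; omega)
  · refine Measurable.comap_le ?_
    exact Measurable.prodMk (hle A (.inl k) (by simp [A])) (hle A (.inr k) (by simp [A]))

variable [IsProbabilityMeasure P]

/-- Chernoff bound at parameter -λ, where each interarrival time contributes a factor 1/2. -/
theorem IsQueue.measureReal_arrivalTime_le (hQ : IsQueue P lam ν X S)
    (hX : ∀ n, Measurable (X n)) (k n : ℕ) (t : ℝ) :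
    P.real {ω | arrivalTime (fun i => X (i + k) ω) n ≤ t} ≤
      Real.exp (lam * t) * (1 / 2) ^ (n + 1) := by
  have hind : iIndepFun (fun i => X (i + k)) P :=
    hQ.indep.precomp (g := fun i => Sum.inl (i + k)) fun i j h => by simpa using h
  have hmgf : mgf (∑ i ∈ Finset.range (n + 1), X (i + k)) P (-lam) = (1 / 2) ^ (n + 1) := by
    rw [hind.mgf_sum fun i => hX (i + k)]
    rw [Finset.prod_eq_pow_card (b := 1 / 2), Finset.card_range]
    intro i _
    have := (hQ.interarrival_law (i + k)).integral_comp (f := fun x => Real.exp (-(lam * x)))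
      (by fun_prop)
    rw [integral_exp_neg_expMeasure hQ.rate_pos] at this
    simpa [mgf, Function.comp_def] using this
  have hi : Integrable (fun ω => Real.exp (-lam * (∑ i ∈ Finset.range (n + 1), X (i + k)) ω)) P := by
    by_contra h
    have := mgf_undef h
    rw [hmgf] at this
    exact absurd this (by positivity)
  have := measure_le_le_exp_mul_mgf t (neg_nonpos.2 hQ.rate_pos.le) hi
  rw [hmgf, neg_neg] at this
  simpa [arrivalTime] using this

theorem IsQueue.ae_exists_lt_arrivalTime (hQ : IsQueue P lam ν X S)
    (hX : ∀ n, Measurable (X n)) (k : ℕ) (t : ℝ) :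
    ∀ᵐ ω ∂P, ∃ n, t < arrivalTime (fun i => X (i + k) ω) n := by
  rw [ae_iff]
  simp only [not_exists, not_lt]
  rw [← measureReal_eq_zero_iff]
  refine le_antisymm ?_ measureReal_nonneg
  have hlim : Filter.Tendsto (fun n : ℕ => Real.exp (lam * t) * (1 / 2 : ℝ) ^ (n + 1)) Filter.atTop
      (nhds (Real.exp (lam * t) * 0)) :=
    (((tendsto_pow_atTop_nhds_zero_of_lt_one (by norm_num) (by norm_num)).comp
      (Filter.tendsto_add_atTop_nat 1))).const_mul _
  rw [mul_zero] at hlim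
  refine ge_of_tendsto' hlim fun n => (measureReal_mono ?_).trans (hQ.measureReal_arrivalTime_le hX k n t)
  exact fun ω (h : ∀ n, arrivalTime (fun i => X (i + k) ω) n ≤ t) => h n

theorem IsQueue.map_customer (hQ : IsQueue P lam ν X S) (k : ℕ) :
    P.map (fun ω => (X k ω, S k ω)) = (expMeasure lam).prod ν := by
  have h : IndepFun (X k) (S k) P := hQ.indep.indepFun (by simp : Sum.inl k ≠ Sum.inr k)
  rw [(indepFun_iff_map_prod_eq_prod_map_map (hQ.interarrival_law k).aemeasurable
    (hQ.service_law k).aemeasurable).1 h, (hQ.interarrival_law k).map_eq,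
    (hQ.service_law k).map_eq]

/-- Conditioning on customer k leaves an independent system of the same kind starting at k + 1;
hence the induction is uniform in k, r and t. -/
theorem IsQueue.integral_stay (hQ : IsQueue P lam ν X S) (hX : ∀ n, Measurable (X n))
    (hS : ∀ n, Measurable (S n)) (n k : ℕ) (r t : ℝ) :
    ∫ ω, stay n (later X S k ω).1 (later X S k ω).2 r t ∂P = stayProb lam ν n r t := by
  have : IsProbabilityMeasure (expMeasure lam) := isProbabilityMeasure_expMeasure hQ.rate_pos
  induction n generalizing k r t with
  | zero => simp [stay, stayProb, stay₀]
  | succ n ih =>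
    let F : (ℝ × ℝ) × ((ℕ → ℝ) × (ℕ → ℝ)) → ℝ := fun q =>
      if q.1.1 ≤ r then stay n q.2.1 q.2.2 (max (r - q.1.1) q.1.2) (t - q.1.1) else 0
    have hF : Measurable F := by
      have hr : Measurable fun q : (ℝ × ℝ) × ((ℕ → ℝ) × (ℕ → ℝ)) => q.1.1 := by fun_prop
      have ha : Measurable fun q : (ℝ × ℝ) × ((ℕ → ℝ) × (ℕ → ℝ)) =>
        (q.2, max (r - q.1.1) q.1.2, t - q.1.1) := by fun_prop
      exact Measurable.ite (measurableSet_le hr measurable_const) ((measurable_stay n).comp ha)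
        measurable_const
    have hC : ∀ q, |F q| ≤ n + 1 := fun q => by
      simp only [F]
      split_ifs
      · exact abs_stay_le _ _ _ _ _
      · rw [abs_zero]; positivity
    have hcust : Measurable fun ω => (X k ω, S k ω) := (hX k).prodMk (hS k)
    have hlat := measurable_later hX hS (k + 1)
    have hset : MeasurableSet {ω | t < X k ω} := measurableSet_lt measurable_const (hX k)
    have e : ∀ ω, stay (n + 1) (later X S k ω).1 (later X S k ω).2 r t =
        stay₀ r t * {ω | t < X k ω}.indicator 1 ω +
          F ((X k ω, S k ω), later X S (k + 1) ω) := by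
      intro ω
      simp only [stay, F, later, zero_add, stay₀, Set.indicator_apply, Set.mem_ofPred_eq,
        Pi.one_apply, add_assoc, add_comm 1 k, mul_ite, mul_one, mul_zero, ← ite_and, and_comm]
    simp only [e]
    rw [integral_add, integral_comp_prodMk_of_indepFun hcust hlat (hQ.indepFun_later hX hS k) hF hC,
      hQ.map_customer k, integral_const_mul, integral_indicator_one hset]
    · simp only [stayProb, firstArrival]
      congr 1
      · by_cases ht : 0 ≤ t
        · rw [← expMeasure_real_Ioi hQ.rate_pos ht,
            (hQ.interarrival_law k).measureReal_eq (p := fun x => t < x) measurableSet_Ioi]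
          rfl
        · simp [stay₀, ht]
      · congr 1 with y
        simp only [F, arrivalKernel]
        split_ifs
        · exact ih _ _ _
        · simp
    · exact ((integrable_const 1).indicator hset).const_mul _
    · exact .of_bound (hF.comp (hcust.prodMk hlat)).aestronglyMeasurable _ (ae_of_all _ fun ω => hC _)

theorem IsQueue.integral_stay_service (hQ : IsQueue P lam ν X S) (hX : ∀ n, Measurable (X n))
    (hS : ∀ n, Measurable (S n)) (n : ℕ) (t : ℝ) :
    ∫ ω, stay n (later X S 1 ω).1 (later X S 1 ω).2 (S 0 ω) t ∂P =
      ∫ s, stayProb lam ν n s t ∂ν := by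
  have hind : IndepFun (S 0) (later X S 1) P :=
    (hQ.indepFun_later hX hS 0).comp measurable_snd measurable_id
  have hF : Measurable fun q : ℝ × ((ℕ → ℝ) × (ℕ → ℝ)) => stay n q.2.1 q.2.2 q.1 t :=
    (measurable_stay n).comp
      (by fun_prop : Measurable fun q : ℝ × ((ℕ → ℝ) × (ℕ → ℝ)) => (q.2, q.1, t))
  rw [integral_comp_prodMk_of_indepFun (hS 0) (measurable_later hX hS 1) hind hF
    (C := n + 1) fun q => abs_stay_le _ _ _ _ _, (hQ.service_law 0).map_eq]
  simp only [hQ.integral_stay hX hS]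

theorem arrivalTime_mono {x : ℕ → ℝ} (hx : ∀ i, 0 < x i) : Monotone (arrivalTime x) :=
  monotone_nat_of_le_succ fun n => by
    rw [arrivalTime, arrivalTime, Finset.sum_range_succ _ (n + 1)]
    linarith [hx (n + 1)]

/-- The tail of the law of the busy period, cut off to `0` on the negative half-line. -/
def busyTail (P : Measure Ω) (X S : ℕ → Ω → ℝ) (t : ℝ) : ℝ :=
  if 0 ≤ t then
    1 - P.real {ω | busyPeriod (fun n => X n ω) (fun n => S n ω) ≤ (t : EReal)} else 0

/-- Almost surely only finitely many arrivals occur by time t, so the truncated indicators are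
eventually equal to the true one; they are bounded by 1, and dominated convergence applies. -/
theorem IsQueue.tendsto_busyTail (hQ : IsQueue P lam ν X S) (hX : ∀ n, Measurable (X n))
    (hS : ∀ n, Measurable (S n)) (t : ℝ) :
    Filter.Tendsto (fun n => ∫ s, stayProb lam ν n s t ∂ν) Filter.atTop
      (nhds (busyTail P X S t)) := by
  have : IsProbabilityMeasure (expMeasure lam) := isProbabilityMeasure_expMeasure hQ.rate_pos
  by_cases ht : 0 ≤ t
  swap
  · simp [stayProb_of_neg _ _ _ (not_le.1 ht), busyTail, ht]
  let A : Set Ω := {ω | Covered (later X S 1 ω).1 (later X S 1 ω).2 (S 0 ω) t}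
  have hm : ∀ n, Measurable fun ω => stay n (later X S 1 ω).1 (later X S 1 ω).2 (S 0 ω) t :=
    fun n => (measurable_stay n).comp
      ((measurable_later hX hS 1).prodMk ((hS 0).prodMk measurable_const))
  have hlim : ∀ᵐ ω ∂P, Filter.Tendsto
      (fun n => stay n (later X S 1 ω).1 (later X S 1 ω).2 (S 0 ω) t) Filter.atTop
      (nhds (A.indicator 1 ω)) := by
    filter_upwards [hQ.ae_interarrival_pos, hQ.ae_exists_lt_arrivalTime hX 1 t] with ω hpos ⟨N, hN⟩
    refine tendsto_const_nhds.congr' ?_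
    filter_upwards [Filter.eventually_ge_atTop N] with n hn
    have hpos' : ∀ i, 0 < (later X S 1 ω).1 i := fun i => hpos (i + 1)
    rw [stay_eq_ite_covered n hpos' ht (hN.trans_le (arrivalTime_mono hpos' hn))]
    by_cases h : Covered (later X S 1 ω).1 (later X S 1 ω).2 (S 0 ω) t
    · rw [if_pos h]; exact Set.indicator_of_mem (s := A) h 1
    · rw [if_neg h]; exact Set.indicator_of_notMem (s := A) h 1
  -- `Covered` quantifies over uncountably many times, so measurability is obtained from the almost
  -- sure limit of measurable functions.
  have hA : NullMeasurableSet A P := by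
    have hae : AEMeasurable (A.indicator (1 : Ω → ℝ)) P :=
      aemeasurable_of_tendsto_metrizable_ae' (fun n => (hm n).aemeasurable) hlim
    have hpre : A = A.indicator (1 : Ω → ℝ) ⁻¹' {1} := by
      ext ω; by_cases h : ω ∈ A <;> simp [h]
    rw [hpre]
    exact hae.nullMeasurableSet_preimage (measurableSet_singleton 1)
  have hval : busyTail P X S t = ∫ ω, A.indicator 1 ω ∂P := by
    have hc : {ω | busyPeriod (fun n => X n ω) (fun n => S n ω) ≤ (t : EReal)} = Aᶜ := by
      ext ω; exact busyPeriod_le_iff ht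
    rw [busyTail, if_pos ht, hc, probReal_compl_eq_one_sub₀ hA, sub_sub_cancel,
      integral_indicator₀ hA]
    simp
  rw [hval]
  simp only [← hQ.integral_stay_service hX hS]
  refine tendsto_integral_of_dominated_convergence (fun _ => 1)
    (fun n => (hm n).aestronglyMeasurable) (integrable_const _) (fun n => ?_) hlim
  filter_upwards [hQ.ae_interarrival_pos] with ω hpos
  rw [Real.norm_eq_abs, abs_of_nonneg (stay_nonneg _ _ _ _ _)]
  exact stay_le_one n (fun i => hpos (i + 1)) _ _

theorem IsQueue.abs_integral_stayProb_le_one (hQ : IsQueue P lam ν X S) (hX : ∀ n, Measurable (X n))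
    (hS : ∀ n, Measurable (S n)) (n : ℕ) (t : ℝ) :
    |∫ s, stayProb lam ν n s t ∂ν| ≤ 1 := by
  rw [← hQ.integral_stay_service hX hS]
  refine (norm_integral_le_of_norm_le_const (C := 1)
    (f := fun ω => stay n (later X S 1 ω).1 (later X S 1 ω).2 (S 0 ω) t) ?_).trans (by simp)
  filter_upwards [hQ.ae_interarrival_pos] with ω hpos
  rw [Real.norm_eq_abs, abs_of_nonneg (stay_nonneg _ _ _ _ _)]
  exact stay_le_one n (fun i => hpos (i + 1)) _ _

variable [IsProbabilityMeasure ν]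

theorem measurable_integral_stayProb (hlam : 0 < lam) (n : ℕ) :
    Measurable fun t => ∫ s, stayProb lam ν n s t ∂ν := by
  have : IsProbabilityMeasure (expMeasure lam) := isProbabilityMeasure_expMeasure hlam
  exact (StronglyMeasurable.integral_prod_left' (f := Function.uncurry (stayProb lam ν n))
    (bddMeas_stayProb hlam n).1.stronglyMeasurable).measurable

theorem IsQueue.measurable_busyTail (hQ : IsQueue P lam ν X S) (hX : ∀ n, Measurable (X n))
    (hS : ∀ n, Measurable (S n)) : Measurable (busyTail P X S) :=
  measurable_of_tendsto_metrizable (measurable_integral_stayProb hQ.rate_pos)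
    (tendsto_pi_nhds.2 (hQ.tendsto_busyTail hX hS))

/-- Decomposition of the busy period according to the last arrival still present at time `t`. -/
theorem IsQueue.busyTail_eq (hQ : IsQueue P lam ν X S) (hX : ∀ n, Measurable (X n))
    (hS : ∀ n, Measurable (S n)) (hint : Integrable (fun x : ℝ => x) ν) {t : ℝ} (ht : 0 ≤ t) :
    busyTail P X S t =
      (1 - cdf ν t) * vac lam ν t + ∫ w, busyTail P X S (t - w) ∂lastMeasure lam ν := by
  have hlam := hQ.rate_pos
  have : IsProbabilityMeasure (expMeasure lam) := isProbabilityMeasure_expMeasure hlam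
  have := isFiniteMeasure_lastMeasure hlam hQ.service_nonneg hint
  have hslice : ∀ {U : ℝ → ℝ → ℝ}, BddMeas U → Integrable (fun s => U s t) ν := by
    rintro U ⟨hU, C, hC⟩
    exact .of_bound (hU.comp (by fun_prop : Measurable fun s : ℝ => (s, t))).aestronglyMeasurable C
      (ae_of_all _ fun s => hC _ _)
  have hV := bddMeas_stayProb (ν := ν) hlam
  have hψ := BddMeas.stay₀_mul_vac ν hlam
  -- The definition of the defect, averaged over an initial work with the service law; the limit n →
  -- ∞ is then taken term by term.
  have hdec : ∀ n, ∫ s, stayProb lam ν n s t ∂ν = (∫ s, lastDefect lam ν n s t ∂ν) +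
      ((1 - cdf ν t) * vac lam ν t +
        ∫ w, ∫ s, stayProb lam ν n s (t - w) ∂ν ∂lastMeasure lam ν) := by
    intro n
    have h1 : ∫ s, lastDefect lam ν n s t ∂ν = (∫ s, stayProb lam ν n s t ∂ν) -
        (∫ s, stay₀ s t * vac lam ν t ∂ν) - ∫ s, lastConv lam ν (stayProb lam ν n) s t ∂ν := by
      have e1 := integral_sub (hslice (hV n)) (hslice hψ)
      have e2 : ∫ s, lastDefect lam ν n s t ∂ν = _ :=
        integral_sub ((hslice (hV n)).sub (hslice hψ)) (hslice (hV n).lastConv)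
      exact e2.trans (congrArg (· - _) e1)
    have h2 : ∫ s, stay₀ s t * vac lam ν t ∂ν = (1 - cdf ν t) * vac lam ν t := by
      rw [integral_mul_const, one_sub_cdf_eq_real, ← integral_indicator_one measurableSet_Ioi]
      congr 2 with s
      simp [stay₀, ht, Set.indicator_apply]
    have h3 : ∫ s, lastConv lam ν (stayProb lam ν n) s t ∂ν =
        ∫ w, ∫ s, stayProb lam ν n s (t - w) ∂ν ∂lastMeasure lam ν := by
      refine integral_integral_swap (f := fun s w => stayProb lam ν n s (t - w)) ?_
      obtain ⟨hm, C, hC⟩ := hV n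
      exact .of_bound (hm.comp
        (by fun_prop : Measurable fun q : ℝ × ℝ => (q.1, t - q.2))).aestronglyMeasurable C
        (ae_of_all _ fun q => hC _ _)
    rw [h1, h2, h3]; ring
  have hdef : Filter.Tendsto (fun n => ∫ s, lastDefect lam ν n s t ∂ν) Filter.atTop (nhds 0) := by
    obtain ⟨C, hC⟩ := exists_abs_lastDefect_le (ν := ν) hlam
    refine squeeze_zero_norm (a := fun n : ℕ => C * Real.exp (lam * t) * (1 / 2 : ℝ) ^ n)
      (fun n => ?_) ?_
    · refine (norm_integral_le_of_norm_le_const (f := fun s => lastDefect lam ν n s t)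
        (ae_of_all _ fun s => hC n s t)).trans_eq ?_
      rw [probReal_univ, one_div, inv_pow]
      ring
    · have := (tendsto_pow_atTop_nhds_zero_of_lt_one (r := (1 / 2 : ℝ)) (by norm_num)
        (by norm_num)).const_mul (C * Real.exp (lam * t))
      rwa [mul_zero] at this
  have hconv : Filter.Tendsto
      (fun n => ∫ w, ∫ s, stayProb lam ν n s (t - w) ∂ν ∂lastMeasure lam ν) Filter.atTop
      (nhds (∫ w, busyTail P X S (t - w) ∂lastMeasure lam ν)) :=
    tendsto_integral_of_dominated_convergence (fun _ => 1)
      (fun n => ((measurable_integral_stayProb hlam n).comp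
        (measurable_const.sub measurable_id)).aestronglyMeasurable)
      (integrable_const _) (fun n => ae_of_all _ fun w => hQ.abs_integral_stayProb_le_one hX hS n _)
      (ae_of_all _ fun w => hQ.tendsto_busyTail hX hS _)
  have hlim := hdef.add (hconv.const_add ((1 - cdf ν t) * vac lam ν t))
  rw [zero_add] at hlim
  exact tendsto_nhds_unique (hQ.tendsto_busyTail hX hS t) (hlim.congr fun n => (hdec n).symm)

theorem busyTail_mem_Icc (t : ℝ) : busyTail P X S t ∈ Set.Icc 0 1 := by
  unfold busyTail
  split_ifs
  · exact ⟨sub_nonneg.2 measureReal_le_one, sub_le_self _ measureReal_nonneg⟩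
  · simp

end

/-! ### Convolution series -/

/-- For either sign of t, the oriented integral is a difference of two integrals over the whole line
of jointly measurable functions. -/
theorem measurable_intervalConv {q p : ℝ → ℝ} (hq : Measurable q) (hp : Measurable p) :
    Measurable fun t => ∫ s in (0 : ℝ)..t, q (t - s) * p s := by
  have hF : Measurable fun z : ℝ × ℝ => q (z.1 - z.2) * p z.2 := by fun_prop
  have h1 : MeasurableSet {z : ℝ × ℝ | 0 < z.2 ∧ z.2 ≤ z.1} :=
    (measurableSet_lt measurable_const measurable_snd).inter
      (measurableSet_le measurable_snd measurable_fst)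
  have h2 : MeasurableSet {z : ℝ × ℝ | z.1 < z.2 ∧ z.2 ≤ 0} :=
    (measurableSet_lt measurable_fst measurable_snd).inter
      (measurableSet_le measurable_snd measurable_const)
  have e : (fun t => ∫ s in (0 : ℝ)..t, q (t - s) * p s) = fun t =>
      (∫ s, {z : ℝ × ℝ | 0 < z.2 ∧ z.2 ≤ z.1}.indicator (fun z => q (z.1 - z.2) * p z.2) (t, s)) -
      ∫ s, {z : ℝ × ℝ | z.1 < z.2 ∧ z.2 ≤ 0}.indicator (fun z => q (z.1 - z.2) * p z.2) (t, s) := by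
    ext t
    rw [intervalIntegral, ← integral_indicator measurableSet_Ioc,
      ← integral_indicator measurableSet_Ioc]
    rfl
  rw [e]
  exact ((hF.indicator h1).stronglyMeasurable.integral_prod_right'.sub
    (hF.indicator h2).stronglyMeasurable.integral_prod_right').measurable

theorem measurable_convPow {f : ℝ → ℝ} (hf : Measurable f) (n : ℕ) : Measurable (convPow f n) := by
  induction n with
  | zero => exact hf
  | succ n ih => exact measurable_intervalConv hf ih

theorem intervalIntegrable_conv {q p : ℝ → ℝ} (hq : Measurable q) (hp : Measurable p) {t C D : ℝ}
    (ht : 0 ≤ t) (hC : ∀ s, 0 ≤ s → s ≤ t → |q s| ≤ C) (hD : ∀ s, 0 ≤ s → s ≤ t → |p s| ≤ D) :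
    IntervalIntegrable (fun s => q (t - s) * p s) volume 0 t := by
  rw [intervalIntegrable_iff_integrableOn_Ioc_of_le ht]
  refine Measure.integrableOn_of_bounded (M := C * D) (by simp)
    (by fun_prop : Measurable fun s => q (t - s) * p s).aestronglyMeasurable ?_
  refine (ae_restrict_iff' measurableSet_Ioc).2 (ae_of_all _ fun s hs => ?_)
  rw [norm_mul]
  have h1 := hC (t - s) (by linarith [hs.2]) (by linarith [hs.1])
  exact mul_le_mul h1 (hD s hs.1.le hs.2) (norm_nonneg _) ((abs_nonneg _).trans h1)

section

variable {f : ℝ → ℝ} {K : ℝ}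

theorem integral_const_sub_pow (K t : ℝ) (n : ℕ) :
    ∫ s in (0 : ℝ)..t, K * (K ^ (n + 1) * (s ^ n / n.factorial)) =
      K ^ (n + 2) * (t ^ (n + 1) / (n + 1).factorial) := by
  simp only [← mul_assoc, mul_div_assoc', intervalIntegral.integral_const_mul,
    intervalIntegral.integral_div, integral_pow]
  rw [Nat.factorial_succ]
  push_cast
  have : (n : ℝ) + 1 ≠ 0 := by positivity
  have : (n.factorial : ℝ) ≠ 0 := by positivity
  simp
  field_simp
  ring

/-- The upper bound is the convolution power of the constant K; its factorial makes the series
converge for every coefficient. -/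
theorem convPow_bounds (hf : Measurable f) (h0 : ∀ t, 0 ≤ t → 0 ≤ f t)
    (hK : ∀ t, 0 ≤ t → f t ≤ K) (n : ℕ) {t : ℝ} (ht : 0 ≤ t) :
    0 ≤ convPow f n t ∧ convPow f n t ≤ K ^ (n + 1) * (t ^ n / n.factorial) := by
  have hK0 : 0 ≤ K := (h0 0 le_rfl).trans (hK 0 le_rfl)
  induction n generalizing t with
  | zero => simpa [convPow] using ⟨h0 t ht, hK t ht⟩
  | succ n ih =>
    refine ⟨intervalIntegral.integral_nonneg ht fun s hs =>
      mul_nonneg (h0 _ (by linarith [hs.2])) (ih hs.1).1, ?_⟩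
    rw [← integral_const_sub_pow]
    refine intervalIntegral.integral_mono_on ht ?_ (by
      apply Continuous.intervalIntegrable; fun_prop) fun s hs => ?_
    · refine intervalIntegrable_conv hf (measurable_convPow hf n) ht (C := K)
        (D := K ^ (n + 1) * (t ^ n / n.factorial)) (fun s hs _ => ?_) fun s hs hst => ?_
      · rw [abs_of_nonneg (h0 s hs)]; exact hK s hs
      · rw [abs_of_nonneg (ih hs).1]
        exact (ih hs).2.trans (by gcongr)
    · exact mul_le_mul (hK _ (by linarith [hs.2])) (ih hs.1).2 (ih hs.1).1 hK0

theorem abs_convPow_le (hf : Measurable f) (h0 : ∀ t, 0 ≤ t → 0 ≤ f t)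
    (hK : ∀ t, 0 ≤ t → f t ≤ K) (n : ℕ) {s t : ℝ} (hs : 0 ≤ s) (hst : s ≤ t) :
    |convPow f n s| ≤ K ^ (n + 1) * (t ^ n / n.factorial) := by
  have hK0 : 0 ≤ K := (h0 0 le_rfl).trans (hK 0 le_rfl)
  have h := convPow_bounds hf h0 hK n hs
  rw [abs_of_nonneg h.1]
  exact h.2.trans (by gcongr)

theorem summable_convPow (hf : Measurable f) (h0 : ∀ t, 0 ≤ t → 0 ≤ f t)
    (hK : ∀ t, 0 ≤ t → f t ≤ K) {c : ℝ} (hc : 0 ≤ c) {t : ℝ} (ht : 0 ≤ t) :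
    Summable fun n : ℕ => c ^ (n + 1) * convPow f n t := by
  refine Summable.of_nonneg_of_le (fun n => mul_nonneg (by positivity)
    (convPow_bounds hf h0 hK n ht).1) (fun n => ?_)
    ((Real.summable_pow_div_factorial (c * K * t)).mul_left (c * K))
  calc c ^ (n + 1) * convPow f n t ≤ c ^ (n + 1) * (K ^ (n + 1) * (t ^ n / n.factorial)) :=
        mul_le_mul_of_nonneg_left (convPow_bounds hf h0 hK n ht).2 (by positivity)
    _ = c * K * ((c * K * t) ^ n / n.factorial) := by
        rw [mul_pow, mul_pow, pow_succ, pow_succ]; ring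

/-- Partial sums of the convolution series. -/
def convSum (f : ℝ → ℝ) (c : ℝ) (M : ℕ) (t : ℝ) : ℝ :=
  ∑ n ∈ Finset.range M, c ^ (n + 1) * convPow f n t

theorem measurable_convSum (hf : Measurable f) (c : ℝ) (M : ℕ) : Measurable (convSum f c M) :=
  Finset.measurable_fun_sum _ fun n _ => (measurable_convPow hf n).const_mul _

theorem exists_abs_convSum_le (hf : Measurable f) (h0 : ∀ t, 0 ≤ t → 0 ≤ f t)
    (hK : ∀ t, 0 ≤ t → f t ≤ K) (c : ℝ) (M : ℕ) (t : ℝ) :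
    ∃ D, ∀ s, 0 ≤ s → s ≤ t → |convSum f c M s| ≤ D :=
  ⟨∑ n ∈ Finset.range M, |c ^ (n + 1)| * (K ^ (n + 1) * (t ^ n / n.factorial)), fun s hs hst =>
    (Finset.abs_sum_le_sum_abs _ _).trans (Finset.sum_le_sum fun n _ => by
      rw [abs_mul]
      exact mul_le_mul_of_nonneg_left (abs_convPow_le hf h0 hK n hs hst) (abs_nonneg _))⟩

theorem convSum_succ (hf : Measurable f) (h0 : ∀ t, 0 ≤ t → 0 ≤ f t)
    (hK : ∀ t, 0 ≤ t → f t ≤ K) (c : ℝ) (M : ℕ) {t : ℝ} (ht : 0 ≤ t) :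
    convSum f c (M + 1) t =
      c * f t + ∫ s in (0 : ℝ)..t, c * f (t - s) * convSum f c M s := by
  have h1 : ∀ s, c * f (t - s) * convSum f c M s =
      ∑ n ∈ Finset.range M, c ^ (n + 2) * (f (t - s) * convPow f n s) := fun s => by
    rw [convSum, Finset.mul_sum]
    exact Finset.sum_congr rfl fun n _ => by ring
  simp only [h1]
  rw [intervalIntegral.integral_finsetSum, convSum, Finset.sum_range_succ', add_comm]
  · simp only [intervalIntegral.integral_const_mul, convPow, zero_add, pow_one]
  · intro n _
    refine (intervalIntegrable_conv hf (measurable_convPow hf n) ht (C := K)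
      (fun s hs _ => ?_) fun s hs hst => abs_convPow_le hf h0 hK n hs hst).const_mul _
    rw [abs_of_nonneg (h0 s hs)]; exact hK s hs

/-! ### Comparison of a renewal solution with the convolution series -/

variable {g H : ℝ → ℝ} {c B : ℝ}

/-- The partial sums iterate the renewal map with the smaller kernel `c * f`, starting from 0 ≤ H;
all kernels are nonnegative, so the order persists. -/
theorem convSum_le_of_renewal (hf : Measurable f) (h0 : ∀ t, 0 ≤ t → 0 ≤ f t)
    (hK : ∀ t, 0 ≤ t → f t ≤ K) (hg : Measurable g) (hH : Measurable H) (hc : 0 ≤ c)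
    (hHb : ∀ t, 0 ≤ t → 0 ≤ H t ∧ H t ≤ B) (hfg : ∀ t, 0 ≤ t → c * f t ≤ g t)
    (hgb : ∀ t, 0 ≤ t → g t ≤ B)
    (hren : ∀ t, 0 ≤ t → H t = g t + ∫ s in (0 : ℝ)..t, g (t - s) * H s) (M : ℕ) {t : ℝ}
    (ht : 0 ≤ t) : convSum f c M t ≤ H t := by
  have hg0 : ∀ t, 0 ≤ t → 0 ≤ g t := fun t ht => (mul_nonneg hc (h0 t ht)).trans (hfg t ht)
  induction M generalizing t with
  | zero => simpa [convSum] using (hHb t ht).1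
  | succ M ih =>
    rw [convSum_succ hf h0 hK c M ht, hren t ht]
    obtain ⟨D, hD⟩ := exists_abs_convSum_le hf h0 hK c M t
    refine add_le_add (hfg t ht) (intervalIntegral.integral_mono_on ht ?_ ?_ fun s hs => ?_)
    · refine intervalIntegrable_conv (q := fun s => c * f s) (hf.const_mul c)
        (measurable_convSum hf c M) ht (C := B) (fun s hs _ => ?_) hD
      rw [abs_of_nonneg (mul_nonneg hc (h0 s hs))]
      exact (hfg s hs).trans (hgb s hs)
    · refine intervalIntegrable_conv hg hH ht (C := B) (D := B) (fun s hs _ => ?_) fun s hs _ => ?_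
      · rw [abs_of_nonneg (hg0 s hs)]; exact hgb s hs
      · rw [abs_of_nonneg (hHb s hs).1]; exact (hHb s hs).2
    · have hts : 0 ≤ t - s := by linarith [hs.2]
      exact (mul_le_mul_of_nonneg_left (ih hs.1) (mul_nonneg hc (h0 _ hts))).trans
        (mul_le_mul_of_nonneg_right (hfg _ hts) (hHb s hs.1).1)

/-- The same iteration with the larger kernel, starting from H ≤ B. Each step convolves the
remainder with a kernel at most B, which produces the factorial term. -/
theorem le_convSum_of_renewal (hf : Measurable f) (h0 : ∀ t, 0 ≤ t → 0 ≤ f t)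
    (hK : ∀ t, 0 ≤ t → f t ≤ K) (hg : Measurable g) (hH : Measurable H) (hc : 0 ≤ c)
    (hHb : ∀ t, 0 ≤ t → 0 ≤ H t ∧ H t ≤ B) (hg0 : ∀ t, 0 ≤ t → 0 ≤ g t)
    (hgf : ∀ t, 0 ≤ t → g t ≤ c * f t) (hcb : ∀ t, 0 ≤ t → c * f t ≤ B)
    (hren : ∀ t, 0 ≤ t → H t = g t + ∫ s in (0 : ℝ)..t, g (t - s) * H s) (M : ℕ) {t : ℝ}
    (ht : 0 ≤ t) : H t ≤ convSum f c M t + B ^ (M + 1) * (t ^ M / M.factorial) := by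
  have hcf0 : ∀ t, 0 ≤ t → 0 ≤ c * f t := fun t ht => mul_nonneg hc (h0 t ht)
  have hcf : Measurable fun s => c * f s := hf.const_mul c
  have hcfb : ∀ s, 0 ≤ s → s ≤ t → |c * f s| ≤ B := fun s hs _ => by
    rw [abs_of_nonneg (hcf0 s hs)]; exact hcb s hs
  have hB : 0 ≤ B := (hcf0 0 le_rfl).trans (hcb 0 le_rfl)
  induction M generalizing t with
  | zero => simpa [convSum] using (hHb t ht).2
  | succ M ih =>
    rw [convSum_succ hf h0 hK c M ht, hren t ht, ← integral_const_sub_pow, add_assoc]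
    obtain ⟨D, hD⟩ := exists_abs_convSum_le hf h0 hK c M t
    have hi1 : IntervalIntegrable (fun s => c * f (t - s) * convSum f c M s) volume 0 t :=
      intervalIntegrable_conv hcf (measurable_convSum hf c M) ht hcfb hD
    have hi2 : IntervalIntegrable (fun s => B * (B ^ (M + 1) * (s ^ M / M.factorial))) volume 0 t :=
      Continuous.intervalIntegrable (by fun_prop) _ _
    rw [← intervalIntegral.integral_add hi1 hi2]
    refine add_le_add (hgf t ht) (intervalIntegral.integral_mono_on ht ?_ (hi1.add hi2)
      fun s hs => ?_)
    · refine intervalIntegrable_conv hg hH ht (C := B) (D := B) (fun s hs _ => ?_) fun s hs _ => ?_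
      · rw [abs_of_nonneg (hg0 s hs)]; exact (hgf s hs).trans (hcb s hs)
      · rw [abs_of_nonneg (hHb s hs).1]; exact (hHb s hs).2
    · have hts : 0 ≤ t - s := by linarith [hs.2]
      have hs0 := hs.1
      have hR : 0 ≤ B ^ (M + 1) * (s ^ M / M.factorial) := by positivity
      calc g (t - s) * H s ≤ c * f (t - s) * H s :=
            mul_le_mul_of_nonneg_right (hgf _ hts) (hHb s hs.1).1
        _ ≤ c * f (t - s) * (convSum f c M s + B ^ (M + 1) * (s ^ M / M.factorial)) :=
            mul_le_mul_of_nonneg_left (ih hs.1 fun u hu hus => hcfb u hu (hus.trans hs.2))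
              (hcf0 _ hts)
        _ ≤ _ := by
            rw [mul_add]
            exact add_le_add le_rfl (mul_le_mul_of_nonneg_right (hcb _ hts) hR)

end

/-! ### The bounds -/

section

variable {Ω : Type*} [MeasurableSpace Ω] {P : Measure Ω}
  {lam : ℝ} {ν : Measure ℝ} {X S : ℕ → Ω → ℝ}

/-- Having a law gives only almost everywhere measurability; measurable versions leave the law of
the busy period unchanged. -/
theorem IsQueue.exists_measurable (hQ : IsQueue P lam ν X S) :
    ∃ X' S' : ℕ → Ω → ℝ, IsQueue P lam ν X' S' ∧ (∀ n, Measurable (X' n)) ∧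
      (∀ n, Measurable (S' n)) ∧ ∀ᵐ ω ∂P, ∀ n, X n ω = X' n ω ∧ S n ω = S' n ω := by
  have hX := fun n => (hQ.interarrival_law n).aemeasurable
  have hS := fun n => (hQ.service_law n).aemeasurable
  refine ⟨fun n => (hX n).mk, fun n => (hS n).mk,
    ⟨hQ.rate_pos, hQ.service_nonneg, fun n => (hQ.interarrival_law n).congr (hX n).ae_eq_mk.symm,
      fun n => (hQ.service_law n).congr (hS n).ae_eq_mk.symm, hQ.indep.congr ?_⟩,
    fun n => (hX n).measurable_mk, fun n => (hS n).measurable_mk,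
    ae_all_iff.2 fun n => (hX n).ae_eq_mk.and (hS n).ae_eq_mk⟩
  rintro (n | n)
  exacts [(hX n).ae_eq_mk, (hS n).ae_eq_mk]

variable [IsProbabilityMeasure P] [IsProbabilityMeasure ν]

/-- Substituting s = t - w, the convolution over (0, ∞) reduces to [0, t) because `busyTail`
vanishes at negative times. -/
theorem IsQueue.renewal_busyTail (hQ : IsQueue P lam ν X S) (hX : ∀ n, Measurable (X n))
    (hS : ∀ n, Measurable (S n)) (hint : Integrable (fun x : ℝ => x) ν) {t : ℝ} (ht : 0 ≤ t) :
    lam * busyTail P X S t = lastDensity lam ν t +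
      ∫ s in (0 : ℝ)..t, lastDensity lam ν (t - s) * (lam * busyTail P X S s) := by
  have h1 : ∫ w, busyTail P X S (t - w) ∂lastMeasure lam ν =
      ∫ s in (0 : ℝ)..t, lastDensity lam ν (t - s) * busyTail P X S s := by
    rw [integral_lastMeasure ν hQ.rate_pos, intervalIntegral.integral_of_le ht,
      ← integral_indicator measurableSet_Ioi, ← integral_sub_left_eq_self _ volume t,
      ← restrict_Ioo_eq_restrict_Ioc, restrict_Ioo_eq_restrict_Ico,
      ← integral_indicator measurableSet_Ico]
    congr 1 with s
    simp only [Set.indicator_apply, Set.mem_Ioi, Set.mem_Ico, sub_pos, sub_sub_cancel]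
    by_cases h1 : s < t <;> by_cases h2 : 0 ≤ s <;> simp [h1, h2, busyTail]
  rw [hQ.busyTail_eq hX hS hint ht, h1, mul_add, ← intervalIntegral.integral_const_mul]
  congr 1
  · rw [lastDensity]; ring
  · congr 1 with s; ring

end

end MGInf

end

theorem mainTheorem2 {Ω : Type*} [MeasurableSpace Ω] (P : Measure Ω) [IsProbabilityMeasure P]
    (lam : ℝ) (ν : Measure ℝ) [IsProbabilityMeasure ν] (X S : ℕ → Ω → ℝ)
    (hQ : MGInf.IsQueue P lam ν X S)
    (hint : Integrable (fun x : ℝ => x) ν) (hmean : 0 < MGInf.meanService ν)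
    (ρ : ℝ) (hρ : ρ = lam * MGInf.meanService ν) (t : ℝ) (ht : 0 ≤ t) :
    (Summable (fun n : ℕ => ρ ^ (n + 1) * Real.exp (-((n + 1 : ℕ) * ρ)) *
        MGInf.convPow (MGInf.equilibriumDensity ν) n t) ∧
      P.real {ω | MGInf.busyPeriod (fun n => X n ω) (fun n => S n ω) ≤ (t : EReal)} ≤
        1 - lam⁻¹ * ∑' n : ℕ, ρ ^ (n + 1) * Real.exp (-((n + 1 : ℕ) * ρ)) *
          MGInf.convPow (MGInf.equilibriumDensity ν) n t) ∧
    (Summable (fun n : ℕ => ρ ^ (n + 1) *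
        MGInf.convPow (MGInf.equilibriumDensity ν) n t) ∧
      1 - lam⁻¹ * ∑' n : ℕ, ρ ^ (n + 1) *
          MGInf.convPow (MGInf.equilibriumDensity ν) n t ≤
        P.real {ω | MGInf.busyPeriod (fun n => X n ω) (fun n => S n ω) ≤ (t : EReal)}) := by
  obtain ⟨X', S', hQ', hX, hS, hae⟩ := hQ.exists_measurable
  have hlam := hQ.rate_pos
  have hprob : P.real {ω | MGInf.busyPeriod (fun n => X n ω) (fun n => S n ω) ≤ (t : EReal)} =
      1 - MGInf.busyTail P X' S' t := by
    rw [MGInf.busyTail, if_pos ht, sub_sub_cancel]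
    refine measureReal_congr ?_
    filter_upwards [hae] with ω hω
    have h1 : (fun n => X n ω) = fun n => X' n ω := funext fun n => (hω n).1
    have h2 : (fun n => S n ω) = fun n => S' n ω := funext fun n => (hω n).2
    change (MGInf.busyPeriod _ _ ≤ _) = (MGInf.busyPeriod _ _ ≤ _)
    rw [h1, h2]
  have hρ0 : 0 < ρ := hρ ▸ mul_pos hlam hmean
  set f := MGInf.equilibriumDensity ν
  have hf_eq : ∀ s, f s = (1 - cdf ν s) / MGInf.meanService ν := MGInf.equilibriumDensity_eq ν
  have hρf : ∀ s, ρ * f s = lam * (1 - cdf ν s) := fun s => by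
    rw [hf_eq, hρ]; field_simp
  have hf : Measurable f := by
    rw [funext hf_eq]
    exact (measurable_const.sub (MGInf.measurable_cdf ν)).div_const _
  have h0 : ∀ s, 0 ≤ s → 0 ≤ f s := fun s _ => by
    rw [hf_eq]; exact div_nonneg (MGInf.one_sub_cdf_nonneg ν s) hmean.le
  have hK : ∀ s, 0 ≤ s → f s ≤ 1 / MGInf.meanService ν := fun s _ => by
    rw [hf_eq]; exact div_le_div_of_nonneg_right (MGInf.one_sub_cdf_le_one ν s) hmean.le
  have hg := MGInf.measurable_lastDensity ν lam
  have hg0 : ∀ s, 0 ≤ s → 0 ≤ MGInf.lastDensity lam ν s :=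
    fun s _ => MGInf.lastDensity_nonneg ν hlam s
  have hgf : ∀ s, 0 ≤ s → MGInf.lastDensity lam ν s ≤ ρ * f s := fun s hs => by
    rw [hρf]
    exact mul_le_of_le_one_right (mul_nonneg hlam.le (MGInf.one_sub_cdf_nonneg ν s))
      (MGInf.vac_le_one ν hlam hs)
  have hfg : ∀ s, 0 ≤ s → ρ * Real.exp (-ρ) * f s ≤ MGInf.lastDensity lam ν s := fun s hs => by
    rw [mul_right_comm, hρf, MGInf.lastDensity]
    refine mul_le_mul_of_nonneg_left (Real.exp_le_exp.2 (neg_le_neg ?_))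
      (mul_nonneg hlam.le (MGInf.one_sub_cdf_nonneg ν s))
    rw [hρ]
    exact mul_le_mul_of_nonneg_left
      (MGInf.integral_one_sub_cdf_le_meanService hQ.service_nonneg hint hs) hlam.le
  have hρfb : ∀ s, 0 ≤ s → ρ * f s ≤ lam := fun s _ => by
    rw [hρf]; exact mul_le_of_le_one_right hlam.le (MGInf.one_sub_cdf_le_one ν s)
  have hH : Measurable fun s => lam * MGInf.busyTail P X' S' s :=
    (hQ'.measurable_busyTail hX hS).const_mul lam
  have hHb : ∀ s, 0 ≤ s → 0 ≤ lam * MGInf.busyTail P X' S' s ∧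
      lam * MGInf.busyTail P X' S' s ≤ lam := fun s _ =>
    ⟨mul_nonneg hlam.le (MGInf.busyTail_mem_Icc s).1,
      mul_le_of_le_one_right hlam.le (MGInf.busyTail_mem_Icc s).2⟩
  have hren : ∀ s, 0 ≤ s → lam * MGInf.busyTail P X' S' s = _ :=
    fun s hs => hQ'.renewal_busyTail hX hS hint hs
  -- With this coefficient, the factor e^{-nρ} of the series is absorbed into the n-th power.
  have hc : 0 ≤ ρ * Real.exp (-ρ) := by positivity
  have hpow : ∀ n : ℕ, ρ ^ (n + 1) * Real.exp (-((n + 1 : ℕ) * ρ)) =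
      (ρ * Real.exp (-ρ)) ^ (n + 1) := fun n => by
    rw [mul_pow, ← Real.exp_nat_mul, mul_neg]
  simp only [hpow, hprob]
  have hs1 := MGInf.summable_convPow hf h0 hK hc ht
  have hs2 := MGInf.summable_convPow hf h0 hK hρ0.le ht
  refine ⟨⟨hs1, ?_⟩, hs2, ?_⟩
  · have hle := le_of_tendsto' hs1.hasSum.tendsto_sum_nat fun M =>
      MGInf.convSum_le_of_renewal hf h0 hK hg hH hc hHb hfg
        (fun s hs => (hgf s hs).trans (hρfb s hs)) hren M ht
    rw [sub_le_sub_iff_left, inv_mul_le_iff₀ hlam]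
    exact hle
  · have hR : Filter.Tendsto (fun M : ℕ => lam ^ (M + 1) * (t ^ M / M.factorial)) Filter.atTop
        (nhds 0) := by
      have := (FloorSemiring.tendsto_pow_div_factorial_atTop (lam * t)).const_mul lam
      rw [mul_zero] at this
      refine this.congr fun M => ?_
      rw [mul_pow, pow_succ]; ring
    have hlim := hs2.hasSum.tendsto_sum_nat.add hR
    rw [add_zero] at hlim
    have hle := ge_of_tendsto' hlim fun M =>
      MGInf.le_convSum_of_renewal hf h0 hK hg hH hρ0.le hHb hg0 hgf hρfb hren M ht
    rw [sub_le_sub_iff_left, le_inv_mul_iff₀ hlam]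
    exact hle
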